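/- Setting. Let $n\ge 2$ and let $\mathcal G=(\mathcal V,\mathcal E)$, $\mathcal V=\{1,\dots,n\}$, be a strongly connected digraph; $d_g$ is its diameter (the largest length of a shortest directed path), $\mathcal N^i_{\rm in}=\{j:(j,i)\in\mathcal E\}\cup\{i\}$ and $\mathcal N^i_{\rm out}=\{j:(i,j)\in\mathcal E\}\cup\{i\}$. Let $f_1,\dots,f_n:\mathbb R^m\to\mathbb R$ be differentiable with $\|\nabla f_i(u)-\nabla f_i(v)\|_2\le\beta\|u-v\|_2$ for all $u,v$, where $\beta>0$. Suppose that $f=\sum_{i}f_i$ has a nonempty set $\mathcal X^\star$ of global minimizers and satisfies, with $f^\star=\min f$ and some $\alpha>0$, the Polyak–Łojasiewicz condition $2\alpha(f(u)-f^\star)\le\|\nabla f(u)\|_2^2$ for all $u$. Algorithm (APPG). Node $i$ has a stepsize $\gamma_i>0$. At a common initial time $t(0)$ each node $i$ picks an arbitrary $x_i\in\mathbb R^m$, sets $g_i=y_i=\nabla f_i(x_i)$, and broadcasts $\tilde x_i=x_i$ and $\tilde y_i=y_i/|\mathcal N^i_{\rm out}|$ to $\mathcal N^i_{\rm out}$.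 Let $t(1)<t(2)<\cdots$ be the later times at which at least one node is activated. Whenever node $i$ is activated, let $\mathcal X_i$, $\mathcal Y_i$ be the collections of all vectors $\tilde x_j$, $\tilde y_j$ ($j\in\mathcal N_{\rm in}^i$) broadcast before that activation, arrived by it, and not used at an earlier activation of $i$. The node updates $$x_i\leftarrow\mathrm{avg}(\mathcal X_i),\quad g_i^-\leftarrow g_i,\quad g_i\leftarrow\nabla f_i(x_i),\quad y_i\leftarrow\mathrm{sum}(\mathcal Y_i)+g_i-g_i^-,\quad \tilde x_i\leftarrow x_i-\gamma_iy_i,$$ and at once broadcasts $\tilde x_i$ and $\tilde y_i=y_i/|\mathcal N^i_{\rm out}|$ to $\mathcal N^i_{\rm out}$; its copy to itself is available without delay at its own next activation. Nodes that are not activated keep their variables. Every node is activated infinitely often, the time between two consecutive activations of the same node lies in $[\underline\tau,\bar\tau]$ with $0<\underline\tau\le\bar\tau<\infty$, and each (nonnegative, possibly time-varying) transmission delay along an edge is at most $\tau$, where $0<\tau<\infty$. Let $x_i(k),y_i(k)$ be the state of node $i$ after the initialization ($k=0$) or after the updates at time $t(k)$ ($k\ge1$). Constants. Put $\bar\gamma=\max_i\gamma_i$,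 $\underline\gamma=\min_i\gamma_i$, $b=n(\bar\tau+\tau)/\underline\tau$, $b'=(n-1)\lfloor\bar\tau/\underline\tau\rfloor+1+n\lfloor\tau/\underline\tau\rfloor$, $\tilde n=n(2b'+1)$, $\theta=(1/\tilde n)^{d_gb'}\in(0,1)$, $\rho=(1-\theta)^{1/(d_gb')}$ and $\mu=\theta^2/(2\tilde n)$. Let $\tilde t\in\mathbb N$ be any number with $2\rho^{\tilde t}\le\mu$. Theorem. There is $\gamma_0>0$, depending only on $\mathcal G,\alpha,\beta,\underline\tau,\bar\tau,\tau$, such that, whenever $\bar\gamma\le\gamma_0$ and $$\lambda\in\Big(\max\Big\{1-\frac{1-\theta}{2\tilde t},\ 1-\frac{\underline\gamma\,\alpha\theta n}{8b}\Big\},\ 1\Big),$$ there is an optimal solution $x^\star\in\mathcal X^\star$ with $$\|x_i(k)-x^\star\|_2=\mathcal O(\lambda^k)\quad\text{and}\quad\|y_i(k)\|_2=\mathcal O(\lambda^k)\quad(k\to\infty)\qquad\text{for all }i\in\mathcal V.$$ -/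

import Mathlib

namespace APPG

open scoped Classical in
/-- Out-neighbours of a node, the node itself included. -/
noncomputable def outNbrs {n : ℕ} (G : Digraph (Fin n)) (i : Fin n) : Finset (Fin n) :=
  Finset.univ.filter fun j => G.Adj i j ∨ j = i

open scoped Classical in
/-- In-neighbours of a node, the node itself included. -/
noncomputable def inNbrs {n : ℕ} (G : Digraph (Fin n)) (i : Fin n) : Finset (Fin n) :=
  Finset.univ.filter fun j => G.Adj j i ∨ j = i

/-- `HasPath G l i j`: there is a directed path with `l` edges from `i` to `j`. -/
inductive HasPath {n : ℕ} (G : Digraph (Fin n)) : ℕ → Fin n → Fin n → Prop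
  | nil (i : Fin n) : HasPath G 0 i i
  | snoc {l : ℕ} {i j k : Fin n} : HasPath G l i j → G.Adj j k → HasPath G (l + 1) i k

/-- Every node can be reached from every node along a directed path. -/
def StronglyConnected {n : ℕ} (G : Digraph (Fin n)) : Prop :=
  ∀ i j, ∃ l, HasPath G l i j

/-- The number of edges of a shortest directed path from `i` to `j`. -/
noncomputable def dist {n : ℕ} (G : Digraph (Fin n)) (i j : Fin n) : ℕ :=
  sInf {l | HasPath G l i j}

/-- The largest distance between two nodes. -/
noncomputable def diameter {n : ℕ} (G : Digraph (Fin n)) : ℕ :=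
  Finset.univ.sup fun p : Fin n × Fin n => dist G p.1 p.2

/-- The timing of an asynchronous execution. `time 0` is the time of the initialization, and
`time 1 < time 2 < ⋯` are the times at which some node is activated; `active k` is the set of the
nodes activated at `time k` (it is used for `1 ≤ k` only). `delay p i j` is the transmission delay
to node `j` of the message which node `i` broadcasts at `time p`. -/
structure Schedule (n : ℕ) where
  time : ℕ → ℝ
  active : ℕ → Set (Fin n)
  delay : ℕ → Fin n → Fin n → ℝ
  time_strictMono : StrictMono time
  active_nonempty : ∀ k, 1 ≤ k → (active k).Nonempty
  delay_nonneg : ∀ p i j, 0 ≤ delay p i j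

namespace Schedule

variable {n : ℕ}

/-- Node `i` broadcasts at the initialization and at each of its activations. -/
def Sends (S : Schedule n) (i : Fin n) (p : ℕ) : Prop :=
  p = 0 ∨ i ∈ S.active p

/-- The time at which the message broadcast by `j` at `time p` is in the buffer of node `i`; the
copy which a node keeps for itself is not transmitted and so has no delay. -/
noncomputable def arrival (S : Schedule n) (p : ℕ) (j i : Fin n) : ℝ :=
  if j = i then S.time p else S.time p + S.delay p j i

/-- `p < q` are (the indices of) two consecutive activations of node `i`. -/
def Consecutive (S : Schedule n) (i : Fin n) (p q : ℕ) : Prop :=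
  1 ≤ p ∧ p < q ∧ i ∈ S.active p ∧ i ∈ S.active q ∧ ∀ r, p < r → r < q → i ∉ S.active r

/-- Every node is activated again and again, and the time between two consecutive activations of
a node lies in `[τlo, τhi]`. -/
def BoundedActivation (S : Schedule n) (τlo τhi : ℝ) : Prop :=
  (∀ i k, ∃ q, k < q ∧ i ∈ S.active q) ∧
  ∀ i p q, S.Consecutive i p q →
    τlo ≤ S.time q - S.time p ∧ S.time q - S.time p ≤ τhi

/-- The transmission delays along the edges of `G` are at most `τ`. -/
def BoundedDelay (S : Schedule n) (G : Digraph (Fin n)) (τ : ℝ) : Prop :=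
  ∀ i j, G.Adj i j → ∀ p, S.Sends i p → S.delay p i j ≤ τ

open scoped Classical in
/-- The content of the buffers of node `i` when it is activated at `time k`: the pairs `(j, p)`
such that the message broadcast by the in-neighbour `j` at `time p` has arrived by `time k`, and
had not yet arrived at any activation of `i` between `time p` and `time k` (at which the buffers
were emptied). -/
noncomputable def buffer (S : Schedule n) (G : Digraph (Fin n)) (i : Fin n) (k : ℕ) :
    Finset (Fin n × ℕ) :=
  (inNbrs G i ×ˢ Finset.range k).filter fun s =>
    S.Sends s.1 s.2 ∧ S.arrival s.2 s.1 i ≤ S.time k ∧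
      ∀ q, s.2 < q → q < k → i ∈ S.active q → S.time q < S.arrival s.2 s.1 i

end Schedule

/-- The variables of all nodes. Index `0` refers to the values after the initialization, index
`k` to the values after the updates at `time k`, i.e. just before `time (k + 1)`. `xt` and `yt`
are the vectors that are broadcast. -/
structure Trajectory (n : ℕ) (E : Type*) where
  x : ℕ → Fin n → E
  y : ℕ → Fin n → E
  g : ℕ → Fin n → E
  xt : ℕ → Fin n → E
  yt : ℕ → Fin n → E

/-- `R` is an execution of the asynchronous push-pull gradient algorithm on the digraph `G` with
local functions `f i`, stepsizes `γ i` and timing `S`, from arbitrary initial vectors `R.x 0 i`. -/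
structure IsExecution {n : ℕ} {E : Type*} [NormedAddCommGroup E] [InnerProductSpace ℝ E]
    [CompleteSpace E] (G : Digraph (Fin n)) (f : Fin n → E → ℝ) (γ : Fin n → ℝ)
    (S : Schedule n) (R : Trajectory n E) : Prop where
  init_g : ∀ i, R.g 0 i = gradient (f i) (R.x 0 i)
  init_y : ∀ i, R.y 0 i = R.g 0 i
  init_xt : ∀ i, R.xt 0 i = R.x 0 i
  init_yt : ∀ i, R.yt 0 i = ((outNbrs G i).card : ℝ)⁻¹ • R.y 0 i
  step_x : ∀ k i, i ∈ S.active (k + 1) → R.x (k + 1) i =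
    ((S.buffer G i (k + 1)).card : ℝ)⁻¹ • ∑ s ∈ S.buffer G i (k + 1), R.xt s.2 s.1
  step_g : ∀ k i, i ∈ S.active (k + 1) → R.g (k + 1) i = gradient (f i) (R.x (k + 1) i)
  step_y : ∀ k i, i ∈ S.active (k + 1) → R.y (k + 1) i =
    ∑ s ∈ S.buffer G i (k + 1), R.yt s.2 s.1 + R.g (k + 1) i - R.g k i
  step_xt : ∀ k i, i ∈ S.active (k + 1) → R.xt (k + 1) i = R.x (k + 1) i - γ i • R.y (k + 1) i
  step_yt : ∀ k i, i ∈ S.active (k + 1) →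
    R.yt (k + 1) i = ((outNbrs G i).card : ℝ)⁻¹ • R.y (k + 1) i
  idle : ∀ k i, i ∉ S.active (k + 1) →
    R.x (k + 1) i = R.x k i ∧ R.y (k + 1) i = R.y k i ∧ R.g (k + 1) i = R.g k i ∧
      R.xt (k + 1) i = R.xt k i ∧ R.yt (k + 1) i = R.yt k i

/-- `h` is differentiable with `β`-Lipschitz gradient. -/
def LipschitzSmooth {E : Type*} [NormedAddCommGroup E] [InnerProductSpace ℝ E] [CompleteSpace E]
    (β : ℝ) (h : E → ℝ) : Prop :=
  Differentiable ℝ h ∧ ∀ u v, ‖gradient h u - gradient h v‖ ≤ β * ‖u - v‖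

/-- The set of global minimizers. -/
def minimizers {E : Type*} (h : E → ℝ) : Set E :=
  {u | ∀ v, h u ≤ h v}

/-- The Polyak–Łojasiewicz inequality with parameter `α`; `⨅ v, h v` is the minimum of `h` whenever
`h` has a minimizer. -/
def PolyakLojasiewicz {E : Type*} [NormedAddCommGroup E] [InnerProductSpace ℝ E] [CompleteSpace E]
    (α : ℝ) (h : E → ℝ) : Prop :=
  ∀ u, 2 * α * (h u - ⨅ v, h v) ≤ ‖gradient h u‖ ^ 2

/-- `(n - 1) ⌊τhi / τlo⌋ + 1 + n ⌊τ / τlo⌋`, the integer asynchrony constant. -/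
noncomputable def bInt (n : ℕ) (τlo τhi τ : ℝ) : ℕ :=
  (n - 1) * ⌊τhi / τlo⌋₊ + 1 + n * ⌊τ / τlo⌋₊

/-- `n (τhi + τ) / τlo`, the asynchrony constant in the rate. -/
noncomputable def bReal (n : ℕ) (τlo τhi τ : ℝ) : ℝ :=
  n * (τhi + τ) / τlo

/-- The number of nodes of the augmented digraph with `2 b` virtual nodes per node. -/
noncomputable def nAug (n : ℕ) (τlo τhi τ : ℝ) : ℕ :=
  n * (2 * bInt n τlo τhi τ + 1)

/-- `θ = (1 / ñ) ^ (d b)`. -/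
noncomputable def theta {n : ℕ} (G : Digraph (Fin n)) (τlo τhi τ : ℝ) : ℝ :=
  (1 / (nAug n τlo τhi τ : ℝ)) ^ (diameter G * bInt n τlo τhi τ)

/-- `ρ = (1 - θ) ^ (1 / (d b))`. -/
noncomputable def rho {n : ℕ} (G : Digraph (Fin n)) (τlo τhi τ : ℝ) : ℝ :=
  (1 - theta G τlo τhi τ) ^ (1 / ((diameter G : ℝ) * (bInt n τlo τhi τ : ℝ)))

/-- `μ = θ² / (2 ñ)`. -/
noncomputable def mu {n : ℕ} (G : Digraph (Fin n)) (τlo τhi τ : ℝ) : ℝ :=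
  theta G τlo τhi τ ^ 2 / (2 * (nAug n τlo τhi τ : ℝ))

end APPG

/-! The analysis works with the messages themselves. A message from `j`, broadcast at index `p`, is
used by `i` at exactly one activation, `use p j i`. After finitely many iterations this happens
within `B` iterations and within time `X`, the sum of the largest activation gap and the largest
delay.

Two quantities then undergo perturbed averaging over the buffers. The broadcast points `xt` are
averaged uniformly and moved by `-γ i • y`. For `y`, let a total mass 1 travel with the messages and
be split as `y` is (push-sum). The mass is conserved, and following the messages along paths shows
that every late activation receives at least a fixed `θ > 0` (`le_mass`, `exists_le_mass`). The
quotient `ratio` of `y` by this mass is averaged too, up to gradient increments divided by the mass.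
By strong connectivity, `T = (d + 3) B` iterations, `d` being the diameter, contract the spread of
either quantity by `1 - κ`, up to the perturbations (`consensus`).

The `y`-mass in flight always equals the sum of the local gradients (`liveSum_yt`). As the shares in
flight add up to 1, that sum is a convex combination of the ratios in flight. So each ratio is close
to the gradient of the sum `F` of the `f i`, and each update is nearly a gradient step for `F` with
a factor in `[θ, 1]`. The Polyak–Łojasiewicz inequality then shrinks the gap `F - b` by `1 -
2αθγ_i`, up to an error of second order in the largest stepsize (`descent`).

Everything is measured by one number `ψ`: gaps at most `ψ ^ 2`, spreads at most a constant times
`step * ψ`. In `T` iterations `ψ` shrinks to `q ψ` (`close_step`). The bound on the stepsizes must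
not involve the smallest stepsize, although the error is quadratic in the largest. If the two are
comparable, the error is absorbed at each activation (`gap_of_comparable`). Otherwise one activation
of the node with the largest stepsize, spread by averaging, gains more than is required
(`gap_of_largest`). Summing geometric bounds gives the limit and the rate; elementary estimates
compare it with the stated constants. -/

namespace APPG

/-! ### Timing of the activations and flow of information -/

namespace Schedule

variable {n : ℕ} {S : Schedule n} {G : Digraph (Fin n)} {τlo τhi τ : ℝ}

/-- The index of the activation at which node `i` uses the message broadcast by `j` at `time p`. -/
noncomputable def use (S : Schedule n) (p : ℕ) (j i : Fin n) : ℕ :=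
  sInf {q | p < q ∧ i ∈ S.active q ∧ S.arrival p j i ≤ S.time q}

theorem exists_last_active (i : Fin n) (q : ℕ) (h : ∃ r, 1 ≤ r ∧ r < q ∧ i ∈ S.active r) :
    ∃ r, 1 ≤ r ∧ r < q ∧ i ∈ S.active r ∧ ∀ r', r < r' → r' < q → i ∉ S.active r' := by
  classical
  obtain ⟨r₀, h1, h2, h3⟩ := h
  obtain ⟨r, hr, hmax⟩ := Finset.exists_max_image
    ((Finset.range q).filter fun r => 1 ≤ r ∧ i ∈ S.active r) id
    ⟨r₀, by simp [h1, h2, h3]⟩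
  simp only [Finset.mem_filter, Finset.mem_range, id] at hr hmax
  refine ⟨r, hr.2.1, hr.1, hr.2.2, fun r' h4 h5 h6 => ?_⟩
  have := hmax r' ⟨h5, by omega, h6⟩
  omega

theorem BoundedActivation.separated (h : S.BoundedActivation τlo τhi) {i : Fin n} {p q : ℕ}
    (hp : 1 ≤ p) (hpq : p < q) (hip : i ∈ S.active p) (hiq : i ∈ S.active q) :
    τlo ≤ S.time q - S.time p := by
  obtain ⟨r, h1, h2, h3, h4⟩ := exists_last_active i q ⟨p, hp, hpq, hip⟩
  have hpr : p ≤ r := by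
    by_contra hlt
    exact h4 p (by omega) hpq hip
  have := (h.2 i r q ⟨h1, h2, h3, hiq, h4⟩).1
  have := S.time_strictMono.monotone hpr
  linarith

theorem BoundedActivation.lo_le_hi (h : S.BoundedActivation τlo τhi) (i : Fin n) : τlo ≤ τhi := by
  obtain ⟨p, hp, hip⟩ := h.1 i 0
  obtain ⟨q, hq, hiq⟩ := h.1 i p
  obtain ⟨r, h1, h2, h3, h4⟩ := exists_last_active i q ⟨p, hp, hq, hip⟩
  have := h.2 i r q ⟨h1, h2, h3, hiq, h4⟩
  linarith

open scoped Classical in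
-- The first of the `c + 1` activations lies strictly after `p`, and each later one costs another
-- `τlo`.
theorem BoundedActivation.lt_of_card (h : S.BoundedActivation τlo τhi) {i : Fin n} {p : ℕ} (c : ℕ) :
    ∀ q, p < q → i ∈ S.active q →
      c + 1 ≤ ((Finset.Ioc p q).filter fun r => i ∈ S.active r).card →
      S.time p + c * τlo < S.time q := by
  induction c with
  | zero =>
    intro q hq _ _
    simpa using S.time_strictMono hq
  | succ c ih =>
    intro q hq hiq hcard
    have hsplit : (Finset.Ioc p q).filter (fun r => i ∈ S.active r) =
        insert q ((Finset.Ioo p q).filter fun r => i ∈ S.active r) := by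
      ext r
      simp only [Finset.mem_filter, Finset.mem_Ioc, Finset.mem_insert, Finset.mem_Ioo]
      constructor
      · rintro ⟨⟨h1, h2⟩, h3⟩
        rcases h2.lt_or_eq with h4 | h4
        · exact Or.inr ⟨⟨h1, h4⟩, h3⟩
        · exact Or.inl h4
      · rintro (rfl | ⟨⟨h1, h2⟩, h3⟩)
        · exact ⟨⟨hq, le_rfl⟩, hiq⟩
        · exact ⟨⟨h1, h2.le⟩, h3⟩
    rw [hsplit, Finset.card_insert_of_notMem (by simp)] at hcard
    have hcard' : c + 1 ≤ ((Finset.Ioo p q).filter fun r => i ∈ S.active r).card := by omega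
    have hne : ((Finset.Ioo p q).filter fun r => i ∈ S.active r).Nonempty := by
      rw [← Finset.card_pos]; omega
    obtain ⟨r, hr, hmax⟩ := Finset.exists_max_image _ id hne
    simp only [Finset.mem_filter, Finset.mem_Ioo, id] at hr hmax
    have := ih r hr.1.1 hr.2 (hcard'.trans (Finset.card_le_card (by
      intro r' h'
      simp only [Finset.mem_filter, Finset.mem_Ioo, Finset.mem_Ioc] at h' ⊢
      exact ⟨⟨h'.1.1, hmax r' h'⟩, h'.2⟩)))
    have := h.separated (by omega) hr.1.2 hr.2 hiq
    push_cast
    linarith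

/-- More than `n * c` iterations take longer than `c * τlo`. -/
theorem BoundedActivation.time_lt (h : S.BoundedActivation τlo τhi) {c p q : ℕ}
    (hpq : p + n * c < q) : S.time p + c * τlo < S.time q := by
  classical
  have hact : ∀ r ∈ Finset.Ioc p q, ∃ i, i ∈ S.active r := fun r hr => by
    have := Finset.mem_Ioc.1 hr
    exact S.active_nonempty r (by omega)
  have : Nonempty (Fin n) := ⟨(S.active_nonempty q (by omega)).some⟩
  choose! node hnode using hact
  -- Pigeonhole: among more than `n * c` iterations, some node is active more than `c` times.
  obtain ⟨i, _, hi⟩ := Finset.exists_lt_card_fiber_of_mul_lt_card_of_maps_to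
    (s := Finset.Ioc p q) (t := (Finset.univ : Finset (Fin n))) (f := node) (n := c)
    (fun _ _ => Finset.mem_univ _) (by simp; omega)
  have hsub : (Finset.Ioc p q).filter (fun r => node r = i) ⊆
      (Finset.Ioc p q).filter fun r => i ∈ S.active r := by
    intro r hr
    simp only [Finset.mem_filter] at hr ⊢
    exact ⟨hr.1, hr.2 ▸ hnode r hr.1⟩
  have hcard := hi.trans_le (Finset.card_le_card hsub)
  obtain ⟨r, hr, hmax⟩ := Finset.exists_max_image
    ((Finset.Ioc p q).filter fun r => i ∈ S.active r) id (by rw [← Finset.card_pos]; omega)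
  simp only [Finset.mem_filter, Finset.mem_Ioc, id] at hr hmax
  have := h.lt_of_card c r hr.1.1 hr.2 (hcard.trans_le (Finset.card_le_card (by
      intro r' h'
      simp only [Finset.mem_filter, Finset.mem_Ioc] at h' ⊢
      exact ⟨⟨h'.1.1, hmax r' h'⟩, h'.2⟩)))
  exact this.trans_le (S.time_strictMono.monotone hr.1.2)

theorem BoundedActivation.exists_time_ge (h : S.BoundedActivation τlo τhi) (hlo : 0 < τlo)
    (a : ℝ) : ∃ k, a ≤ S.time k := by
  obtain ⟨c, hc⟩ := exists_nat_ge ((a - S.time 0) / τlo)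
  refine ⟨0 + n * c + 1, ?_⟩
  have := h.time_lt (c := c) (p := 0) (q := 0 + n * c + 1) (by omega)
  rw [div_le_iff₀ hlo] at hc
  linarith

theorem BoundedActivation.use_spec (h : S.BoundedActivation τlo τhi) (hlo : 0 < τlo)
    (p : ℕ) (j i : Fin n) :
    p < S.use p j i ∧ i ∈ S.active (S.use p j i) ∧ S.arrival p j i ≤ S.time (S.use p j i) := by
  have hne : {q | p < q ∧ i ∈ S.active q ∧ S.arrival p j i ≤ S.time q}.Nonempty := by
    obtain ⟨k, hk⟩ := h.exists_time_ge hlo (S.arrival p j i)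
    obtain ⟨q, hq, hiq⟩ := h.1 i (max k p)
    exact ⟨q, lt_of_le_of_lt (le_max_right _ _) hq, hiq,
      hk.trans (S.time_strictMono.monotone ((le_max_left _ _).trans hq.le))⟩
  exact Nat.sInf_mem hne

theorem use_le {p q : ℕ} {j i : Fin n} (h1 : p < q) (h2 : i ∈ S.active q)
    (h3 : S.arrival p j i ≤ S.time q) : S.use p j i ≤ q :=
  Nat.sInf_le ⟨h1, h2, h3⟩

/-- Eventual regularity of the timing: any `B` consecutive iterations activate every node, and
messages are used within `B` iterations and within time `X`. -/
structure Regular (S : Schedule n) (G : Digraph (Fin n)) (X τlo : ℝ) (B K₀ : ℕ) : Prop where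
  one_le : 1 ≤ K₀
  X_pos : 0 < X
  separated : ∀ i p q, 1 ≤ p → p < q → i ∈ S.active p → i ∈ S.active q →
    τlo ≤ S.time q - S.time p
  exists_active : ∀ i k, K₀ ≤ k → ∃ q, k < q ∧ q ≤ k + B ∧ i ∈ S.active q
  use_spec : ∀ p j i,
    p < S.use p j i ∧ i ∈ S.active (S.use p j i) ∧ S.arrival p j i ≤ S.time (S.use p j i)
  use_bound : ∀ p j i, S.Sends j p → i ∈ outNbrs G j → K₀ < S.use p j i →
    S.use p j i ≤ p + B ∧ S.time (S.use p j i) ≤ S.time p + X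

/-- A message arrives within `τ`, and its receiver is activated at most `τhi` later. Since `τhi + τ
≤ c * τlo`, this time contains at most `n * c` iterations. -/
theorem exists_regular (hA : S.BoundedActivation τlo τhi) (hD : S.BoundedDelay G τ)
    (hlo : 0 < τlo) (hhi : 0 < τhi) (hτ : 0 < τ) {c : ℕ} (hc : τhi + τ ≤ c * τlo) :
    ∃ K₀, S.Regular G (τhi + τ) τlo (n * c) K₀ := by
  classical
  choose a ha hia using fun i => hA.1 i 0
  have hK : ∀ i, a i ≤ 1 + ∑ j, a j := fun i =>
    (Finset.single_le_sum (f := a) (fun _ _ => Nat.zero_le _) (Finset.mem_univ i)).trans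
      (Nat.le_add_left _ _)
  have hidx : ∀ p q, S.time q ≤ S.time p + (τhi + τ) → q ≤ p + n * c := by
    intro p q hq
    by_contra hlt
    have := hA.time_lt (c := c) (p := p) (q := q) (by omega)
    linarith
  have key : ∀ i q b, 1 + ∑ j, a j < q → i ∈ S.active q →
      (∀ r, r < q → i ∈ S.active r → S.time r ≤ b) → S.time q ≤ b + τhi := by
    intro i q b hq hiq hb
    obtain ⟨r, h1, h2, h3, h4⟩ :=
      exists_last_active (S := S) i q ⟨a i, ha i, (hK i).trans_lt hq, hia i⟩
    have := (hA.2 i r q ⟨h1, h2, h3, hiq, h4⟩).2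
    linarith [hb r h2 h3]
  refine ⟨1 + ∑ j, a j, ⟨by omega, by linarith, fun i p q h1 h2 h3 h4 => hA.separated h1 h2 h3 h4,
    ?_, hA.use_spec hlo, ?_⟩⟩
  · intro i k hk
    have hex : ∃ q, k < q ∧ i ∈ S.active q := hA.1 i k
    have hs := Nat.find_spec hex
    refine ⟨Nat.find hex, hs.1, hidx _ _ ?_, hs.2⟩
    have := key i (Nat.find hex) (S.time k) (by omega) hs.2 (fun r hr hir => by
      apply S.time_strictMono.monotone
      by_contra hlt
      exact Nat.find_min hex hr ⟨by omega, hir⟩)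
    linarith
  · intro p j i hs hij hu
    have hsp := hA.use_spec hlo p j i
    have harr : S.arrival p j i ≤ S.time p + τ := by
      unfold arrival
      split_ifs with hji
      · linarith
      · have : G.Adj j i := by
          have := (Finset.mem_filter.1 hij).2
          exact this.resolve_right fun h => hji h.symm
        linarith [hD j i this p hs]
    have ht : S.time (S.use p j i) ≤ S.time p + (τhi + τ) := by
      have := key i (S.use p j i) (S.time p + τ) hu hsp.2.1 (fun r hr hir => by
        by_contra hlt
        have h1 : S.time p < S.time r := by linarith
        have := use_le (S := S) (p := p) (j := j) (S.time_strictMono.lt_iff_lt.1 h1) hir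
          (by linarith)
        omega)
      linarith
    exact ⟨hidx _ _ ht, ht⟩

namespace Regular

variable {X : ℝ} {B K₀ : ℕ}

/-- Buffers are emptied at each activation, so only the first activation that finds a message uses
it. Buffers thus become fibres of `use`, which are disjoint. -/
theorem mem_buffer (h : S.Regular G X τlo B K₀) {i j : Fin n} {k p : ℕ} (hik : i ∈ S.active k) :
    (j, p) ∈ S.buffer G i k ↔ i ∈ outNbrs G j ∧ S.Sends j p ∧ S.use p j i = k := by
  have hnbr : j ∈ inNbrs G i ↔ i ∈ outNbrs G j := by
    simp [inNbrs, outNbrs, eq_comm]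
  obtain ⟨h1, h2, h3⟩ := h.use_spec p j i
  simp only [buffer, Finset.mem_filter, Finset.mem_product, Finset.mem_range, hnbr]
  constructor
  · rintro ⟨⟨h4, h5⟩, h6, h7, h8⟩
    refine ⟨h4, h6, le_antisymm (use_le h5 hik h7) ?_⟩
    by_contra hlt
    have := h8 _ h1 (by omega) h2
    linarith
  · rintro ⟨h4, h5, rfl⟩
    refine ⟨⟨h4, h1⟩, h5, h3, fun q h6 h7 h8 => ?_⟩
    by_contra hlt
    have := use_le (S := S) (j := j) h6 h8 (by linarith)
    omega

theorem sends_of_mem_buffer {i j : Fin n} {k p : ℕ} (hs : (j, p) ∈ S.buffer G i k) :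
    S.Sends j p ∧ p < k := by
  simp only [buffer, Finset.mem_filter, Finset.mem_product, Finset.mem_range] at hs
  exact ⟨hs.2.1, hs.1.2⟩

theorem le_of_mem_buffer (h : S.Regular G X τlo B K₀) {i : Fin n} {k : ℕ} {s : Fin n × ℕ}
    (hk : K₀ < k) (hik : i ∈ S.active k) (hs : s ∈ S.buffer G i k) : k ≤ s.2 + B := by
  obtain ⟨j, p⟩ := s
  obtain ⟨h1, h2, rfl⟩ := (h.mem_buffer hik).1 hs
  exact (h.use_bound p j i h2 h1 hk).1

/-- Every activation uses the previous broadcast of the node itself. -/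
theorem exists_self_mem_buffer (h : S.Regular G X τlo B K₀) {i : Fin n} {k : ℕ} (hk : 1 ≤ k)
    (hik : i ∈ S.active k) : ∃ p, (i, p) ∈ S.buffer G i k ∧
      ∀ r, p < r → r < k → i ∉ S.active r := by
  classical
  have hself : i ∈ outNbrs G i := by simp [outNbrs]
  have main : ∀ p, S.Sends i p → p < k → (∀ r, p < r → r < k → i ∉ S.active r) →
      (i, p) ∈ S.buffer G i k := by
    intro p hs hp hr
    refine (h.mem_buffer hik).2 ⟨hself, hs, ?_⟩
    refine le_antisymm (use_le hp hik ?_) ?_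
    · simpa [arrival] using (S.time_strictMono hp).le
    · by_contra hlt
      exact hr _ (h.use_spec p i i).1 (by omega) (h.use_spec p i i).2.1
  by_cases hex : ∃ r, 1 ≤ r ∧ r < k ∧ i ∈ S.active r
  · obtain ⟨r, h1, h2, h3, h4⟩ := exists_last_active i k hex
    exact ⟨r, main r (Or.inr h3) h2 h4, h4⟩
  · push Not at hex
    have h0 : ∀ r, 0 < r → r < k → i ∉ S.active r := fun r h1 h2 => hex r h1 h2
    exact ⟨0, main 0 (Or.inl rfl) (by omega) h0, h0⟩

end Regular

/-- `Chain G s f e`: information flows from the broadcast `f` to the broadcast `e` via `s` messages. -/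
inductive Chain (S : Schedule n) (G : Digraph (Fin n)) : ℕ → Fin n × ℕ → Fin n × ℕ → Prop
  | nil (e : Fin n × ℕ) : Chain S G 0 e e
  | cons {s k : ℕ} {i : Fin n} {f e : Fin n × ℕ} :
      i ∈ S.active k → f ∈ S.buffer G i k → Chain S G s (i, k) e → Chain S G (s + 1) f e

namespace Chain

variable {a b c : Fin n × ℕ}

theorem trans {s t : ℕ} (h : S.Chain G s a b) (h' : S.Chain G t b c) : S.Chain G (s + t) a c := by
  induction h with
  | nil e => simpa using h'
  | cons h1 h2 _ ih =>
    rw [Nat.add_right_comm]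
    exact cons h1 h2 (ih h')

theorem add_le {s : ℕ} (h : S.Chain G s a b) : a.2 + s ≤ b.2 := by
  induction h with
  | nil e => simp
  | cons h1 h2 _ ih =>
    have := (Regular.sends_of_mem_buffer h2).2
    simp only at ih
    omega

theorem single {i : Fin n} {k : ℕ} (h1 : i ∈ S.active k) (h2 : a ∈ S.buffer G i k) :
    S.Chain G 1 a (i, k) :=
  cons h1 h2 (nil _)

end Chain

namespace Regular

variable {X : ℝ} {B K₀ : ℕ}

/-- A node always uses its own previous broadcast, so waiting is a chain of messages to itself. They
are `τlo` apart, so elapsed time, not the number of iterations, bounds their number; this keeps the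
factor `n` out of the exponent of the mass bound. -/
theorem exists_self_chain (h : S.Regular G X τlo B K₀) {j : Fin n} {q k : ℕ} (hq : 1 ≤ q)
    (hqk : q ≤ k) (hjq : j ∈ S.active q) (hjk : j ∈ S.active k) :
    ∃ w : ℕ, S.Chain G w (j, q) (j, k) ∧ w * τlo ≤ S.time k - S.time q := by
  induction k using Nat.strong_induction_on with
  | _ k ih =>
    rcases hqk.eq_or_lt with rfl | hlt
    · exact ⟨0, Chain.nil _, by simp⟩
    · obtain ⟨p, hp, hlast⟩ := h.exists_self_mem_buffer (by omega) hjk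
      have hpk := (sends_of_mem_buffer hp).2
      have hqp : q ≤ p := by
        by_contra hlt'
        exact hlast q (by omega) hlt hjq
      have hjp : j ∈ S.active p := (sends_of_mem_buffer hp).1.resolve_left (by omega)
      obtain ⟨w, hw, hwt⟩ := ih p hpk hqp hjp
      refine ⟨w + 1, hw.trans (Chain.single hjk hp), ?_⟩
      have := h.separated j p k (by omega) hpk hjp hjk
      push_cast
      linarith

/-- Both clocks are recorded: iterations serve the contraction of averages, time serves the mass
bound. -/
theorem exists_path_chain (h : S.Regular G X τlo B K₀) {l p : ℕ} {i j : Fin n}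
    (hl : HasPath G l i j) (hp : K₀ ≤ p) (hip : i ∈ S.active p) :
    ∃ q, p ≤ q ∧ q ≤ p + l * B ∧ S.time q ≤ S.time p + l * X ∧ j ∈ S.active q ∧
      S.Chain G l (i, p) (j, q) := by
  induction hl with
  | nil i => exact ⟨p, le_rfl, by simp, by simp, hip, Chain.nil _⟩
  | @snoc l i j k _ hjk ih =>
    obtain ⟨q, h1, h2, h3, h4, h5⟩ := ih hip
    have hout : k ∈ outNbrs G j := by simp [outNbrs, hjk]
    have hs := h.use_spec q j k
    obtain ⟨hu1, hu2⟩ := h.use_bound q j k (Or.inr h4) hout (by omega)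
    refine ⟨S.use q j k, by omega, ?_, ?_, hs.2.1, h5.trans (Chain.single hs.2.1
      ((h.mem_buffer hs.2.1).2 ⟨hout, Or.inr h4, rfl⟩))⟩
    · rw [Nat.succ_mul]; omega
    · push_cast; linarith

theorem exists_chain_of_time (h : S.Regular G X τlo B K₀) {l p k : ℕ} {i j : Fin n}
    (hl : HasPath G l i j) (hp : K₀ ≤ p) (hip : i ∈ S.active p) (hjk : j ∈ S.active k)
    (ht : S.time p + l * X ≤ S.time k) :
    ∃ w : ℕ, S.Chain G (l + w) (i, p) (j, k) ∧ w * τlo ≤ S.time k - S.time p := by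
  obtain ⟨q, h1, h2, h3, h4, h5⟩ := h.exists_path_chain hl hp hip
  have h0 := h.one_le
  obtain ⟨w, hw, hwt⟩ := h.exists_self_chain (by omega)
    (S.time_strictMono.le_iff_le.1 (h3.trans ht)) h4 hjk
  exact ⟨w, h5.trans hw, hwt.trans (by linarith [S.time_strictMono.monotone h1])⟩

theorem exists_chain (h : S.Regular G X τlo B K₀) {l p k : ℕ} {i j : Fin n}
    (hl : HasPath G l i j) (hp : K₀ ≤ p) (hip : i ∈ S.active p) (hjk : j ∈ S.active k)
    (ht : p + l * B ≤ k) : ∃ s : ℕ, S.Chain G s (i, p) (j, k) := by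
  obtain ⟨q, h1, h2, h3, h4, h5⟩ := h.exists_path_chain hl hp hip
  have h0 := h.one_le
  obtain ⟨w, hw, -⟩ := h.exists_self_chain (by omega) (h2.trans ht) h4 hjk
  exact ⟨_, h5.trans hw⟩

end Regular

end Schedule

theorem exists_hasPath_le_diameter {n : ℕ} {G : Digraph (Fin n)} (hG : StronglyConnected G)
    (i j : Fin n) : ∃ l ≤ diameter G, HasPath G l i j :=
  ⟨dist G i j, Finset.le_sup (f := fun p : Fin n × Fin n => dist G p.1 p.2)
    (Finset.mem_univ (i, j)), Nat.sInf_mem (hG i j)⟩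

end APPG

/-! ### Messages in flight and the push-sum mass -/

namespace APPG

namespace Schedule

variable {n : ℕ} {S : Schedule n} {G : Digraph (Fin n)} {τlo : ℝ}

theorem card_outNbrs_pos (G : Digraph (Fin n)) (i : Fin n) : 0 < (outNbrs G i).card :=
  Finset.card_pos.2 ⟨i, by simp [outNbrs]⟩

theorem card_outNbrs_le (G : Digraph (Fin n)) (i : Fin n) : (outNbrs G i).card ≤ n := by
  simpa using Finset.card_le_univ (outNbrs G i)

open scoped Classical in
/-- The sum of `φ j p i` over the messages (from `j`, broadcast at `time p`, to `i`) which are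
still unused after the updates at `time k`. -/
noncomputable def liveSum {M : Type*} [AddCommMonoid M] (S : Schedule n) (G : Digraph (Fin n))
    (k : ℕ) (φ : Fin n → ℕ → Fin n → M) : M :=
  ∑ p ∈ Finset.range (k + 1), ∑ j, ∑ i,
    if S.Sends j p ∧ i ∈ outNbrs G j ∧ k < S.use p j i then φ j p i else 0

open scoped Classical in
theorem liveSum_mono {k : ℕ} {φ ψ : Fin n → ℕ → Fin n → ℝ}
    (h : ∀ j p i, p ≤ k → S.Sends j p → i ∈ outNbrs G j → k < S.use p j i → φ j p i ≤ ψ j p i) :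
    S.liveSum G k φ ≤ S.liveSum G k ψ := by
  unfold liveSum
  refine Finset.sum_le_sum fun p hp => Finset.sum_le_sum fun j _ => Finset.sum_le_sum fun i _ => ?_
  split_ifs with hc
  · exact h j p i (by simpa [Nat.lt_succ_iff] using hp) hc.1 hc.2.1 hc.2.2
  · exact le_rfl

theorem liveSum_smul {E : Type*} [AddCommGroup E] [Module ℝ E] {k : ℕ}
    (φ : Fin n → ℕ → Fin n → ℝ) (v : E) :
    S.liveSum G k (fun j p i => φ j p i • v) = S.liveSum G k φ • v := by
  unfold liveSum
  simp only [Finset.sum_smul, ite_smul, zero_smul]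

theorem liveSum_sub {E : Type*} [AddCommGroup E] {k : ℕ} (φ ψ : Fin n → ℕ → Fin n → E) :
    S.liveSum G k (fun j p i => φ j p i - ψ j p i) = S.liveSum G k φ - S.liveSum G k ψ := by
  classical
  unfold liveSum
  simp only [← Finset.sum_sub_distrib]
  refine Finset.sum_congr rfl fun p _ => Finset.sum_congr rfl fun j _ =>
    Finset.sum_congr rfl fun i _ => ?_
  split_ifs <;> simp

theorem norm_liveSum_le {E : Type*} [SeminormedAddCommGroup E] {k : ℕ}
    {φ : Fin n → ℕ → Fin n → E} {ψ : Fin n → ℕ → Fin n → ℝ}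
    (h : ∀ j p i, p ≤ k → S.Sends j p → i ∈ outNbrs G j → k < S.use p j i →
      ‖φ j p i‖ ≤ ψ j p i) : ‖S.liveSum G k φ‖ ≤ S.liveSum G k ψ := by
  classical
  unfold liveSum
  refine (norm_sum_le _ _).trans (Finset.sum_le_sum fun p hp => (norm_sum_le _ _).trans
    (Finset.sum_le_sum fun j _ => (norm_sum_le _ _).trans (Finset.sum_le_sum fun i _ => ?_)))
  split_ifs with hc
  · exact h j p i (by simpa [Nat.lt_succ_iff] using hp) hc.1 hc.2.1 hc.2.2
  · simp

namespace Regular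

variable {X : ℝ} {B K₀ : ℕ} {M : Type*} [AddCommMonoid M]

theorem liveSum_zero (h : S.Regular G X τlo B K₀) (φ : Fin n → ℕ → Fin n → M) :
    S.liveSum G 0 φ = ∑ j, ∑ i ∈ outNbrs G j, φ j 0 i := by
  classical
  have : ∀ j i, 0 < S.use 0 j i := fun j i => (h.use_spec 0 j i).1
  simp [liveSum, Sends, this]

open scoped Classical in
theorem sum_use_eq (h : S.Regular G X τlo B K₀) (k : ℕ) (φ : Fin n → ℕ → Fin n → M) :
    (∑ p ∈ Finset.range (k + 1), ∑ j, ∑ i,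
      if S.Sends j p ∧ i ∈ outNbrs G j ∧ S.use p j i = k + 1 then φ j p i else 0) =
    ∑ i ∈ Finset.univ.filter (fun i => i ∈ S.active (k + 1)),
      ∑ s ∈ S.buffer G i (k + 1), φ s.1 s.2 i := by
  have hbuf : ∀ i ∈ Finset.univ.filter (fun i => i ∈ S.active (k + 1)),
      ∑ s ∈ S.buffer G i (k + 1), φ s.1 s.2 i = ∑ p ∈ Finset.range (k + 1), ∑ j,
        if S.Sends j p ∧ i ∈ outNbrs G j ∧ S.use p j i = k + 1 then φ j p i else 0 := by
    intro i hi
    have hik := (Finset.mem_filter.1 hi).2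
    rw [Finset.sum_comm, ← Finset.sum_product', ← Finset.sum_filter]
    refine Finset.sum_congr ?_ fun _ _ => rfl
    ext ⟨j, p⟩
    simp only [Finset.mem_filter, Finset.mem_product, Finset.mem_univ, true_and,
      Finset.mem_range, h.mem_buffer hik]
    constructor
    · rintro ⟨h1, h2, h3⟩
      exact ⟨h3 ▸ (h.use_spec p j i).1, h2, h1, h3⟩
    · rintro ⟨_, h2, h1, h3⟩
      exact ⟨h1, h2, h3⟩
  rw [Finset.sum_congr rfl hbuf, Finset.sum_filter]
  have hz : ∀ i, i ∉ S.active (k + 1) → ∀ p j, ¬ (S.Sends j p ∧ i ∈ outNbrs G j ∧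
      S.use p j i = k + 1) := fun i hi p j hc => hi (hc.2.2 ▸ (h.use_spec p j i).2.1)
  have hrhs : ∀ i, (if i ∈ S.active (k + 1) then ∑ p ∈ Finset.range (k + 1), ∑ j,
        (if S.Sends j p ∧ i ∈ outNbrs G j ∧ S.use p j i = k + 1 then φ j p i else 0) else 0) =
      ∑ p ∈ Finset.range (k + 1), ∑ j,
        (if S.Sends j p ∧ i ∈ outNbrs G j ∧ S.use p j i = k + 1 then φ j p i else 0) := by
    intro i
    split_ifs with hi
    · rfl
    · symm
      refine Finset.sum_eq_zero fun p _ => Finset.sum_eq_zero fun j _ => if_neg (hz i hi p j)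
  rw [Finset.sum_congr rfl fun i _ => hrhs i,
    Finset.sum_congr rfl fun p _ => Finset.sum_comm, Finset.sum_comm]

open scoped Classical in
-- A live message either stays live or is used at `k + 1`, and the only new ones come from the nodes
-- activated there. The conservation of mass and that of `y` are both instances.
theorem liveSum_succ (h : S.Regular G X τlo B K₀) (k : ℕ) (φ : Fin n → ℕ → Fin n → M) :
    S.liveSum G (k + 1) φ + ∑ i ∈ Finset.univ.filter (fun i => i ∈ S.active (k + 1)),
      ∑ s ∈ S.buffer G i (k + 1), φ s.1 s.2 i =
    S.liveSum G k φ + ∑ i ∈ Finset.univ.filter (fun i => i ∈ S.active (k + 1)),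
      ∑ i' ∈ outNbrs G i, φ i (k + 1) i' := by
  rw [← h.sum_use_eq, liveSum, Finset.sum_range_succ, liveSum]
  have hnew : (∑ j, ∑ i, if S.Sends j (k + 1) ∧ i ∈ outNbrs G j ∧ k + 1 < S.use (k + 1) j i then
      φ j (k + 1) i else 0) = ∑ i ∈ Finset.univ.filter (fun i => i ∈ S.active (k + 1)),
      ∑ i' ∈ outNbrs G i, φ i (k + 1) i' := by
    have : ∀ j i, k + 1 < S.use (k + 1) j i := fun j i => (h.use_spec (k + 1) j i).1
    rw [Finset.sum_filter]
    refine Finset.sum_congr rfl fun j _ => ?_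
    by_cases hj : j ∈ S.active (k + 1) <;> simp [Sends, this, hj]
  have hold : (∑ p ∈ Finset.range (k + 1), ∑ j, ∑ i,
        if S.Sends j p ∧ i ∈ outNbrs G j ∧ k < S.use p j i then φ j p i else 0) =
      (∑ p ∈ Finset.range (k + 1), ∑ j, ∑ i,
        if S.Sends j p ∧ i ∈ outNbrs G j ∧ k + 1 < S.use p j i then φ j p i else 0) +
      ∑ p ∈ Finset.range (k + 1), ∑ j, ∑ i,
        if S.Sends j p ∧ i ∈ outNbrs G j ∧ S.use p j i = k + 1 then φ j p i else 0 := by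
    simp only [← Finset.sum_add_distrib]
    refine Finset.sum_congr rfl fun p _ => Finset.sum_congr rfl fun j _ =>
      Finset.sum_congr rfl fun i _ => ?_
    by_cases hc : S.Sends j p ∧ i ∈ outNbrs G j
    · rcases lt_trichotomy (S.use p j i) (k + 1) with h1 | h1 | h1
      · have h2 : ¬ k < S.use p j i := by omega
        have h3 : ¬ k + 1 < S.use p j i := by omega
        simp [h1.ne, h2, h3]
      · simp [hc, h1]
      · have h2 : k < S.use p j i := by omega
        simp [hc, h1, h1.ne', h2]
    · have h1 : ∀ P : Prop, ¬ (S.Sends j p ∧ i ∈ outNbrs G j ∧ P) := fun P hP =>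
        hc ⟨hP.1, hP.2.1⟩
      simp [h1]
  rw [hnew, hold]
  abel

end Regular

open scoped Classical in
/-- The push-sum mass: the mass which node `i` broadcasts at `time k`, when every node starts with
the mass `1 / n` and each broadcast mass is divided evenly among the out-neighbours. -/
noncomputable def mass (S : Schedule n) (G : Digraph (Fin n)) (k : ℕ) (i : Fin n) : ℝ :=
  if k = 0 then (n : ℝ)⁻¹
  else ∑ p : Fin k, ∑ j, if (j, (p : ℕ)) ∈ S.buffer G i k then
    ((outNbrs G j).card : ℝ)⁻¹ * mass S G p j else 0
termination_by k
decreasing_by exact p.isLt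

theorem mass_zero (S : Schedule n) (G : Digraph (Fin n)) (i : Fin n) :
    S.mass G 0 i = (n : ℝ)⁻¹ := by
  rw [mass]; simp

theorem mass_pos_index (S : Schedule n) (G : Digraph (Fin n)) {k : ℕ} (hk : 1 ≤ k) (i : Fin n) :
    S.mass G k i =
      ∑ s ∈ S.buffer G i k, ((outNbrs G s.1).card : ℝ)⁻¹ * S.mass G s.2 s.1 := by
  classical
  rw [mass, if_neg (by omega)]
  rw [Finset.sum_range (f := fun p => ∑ j, if (j, (p : ℕ)) ∈ S.buffer G i k then
    ((outNbrs G j).card : ℝ)⁻¹ * mass S G p j else 0) |>.symm, Finset.sum_comm,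
    ← Finset.sum_product', ← Finset.sum_filter]
  refine Finset.sum_congr ?_ fun _ _ => rfl
  ext ⟨j, p⟩
  simp only [Finset.mem_filter, Finset.mem_product, Finset.mem_univ, Finset.mem_range, true_and]
  exact ⟨fun h => h.2, fun h => ⟨(Regular.sends_of_mem_buffer h).2, h⟩⟩

/-- The mass carried by one message. -/
noncomputable def share (S : Schedule n) (G : Digraph (Fin n)) (p : ℕ) (j : Fin n) : ℝ :=
  ((outNbrs G j).card : ℝ)⁻¹ * S.mass G p j

theorem mass_nonneg (S : Schedule n) (G : Digraph (Fin n)) (k : ℕ) (i : Fin n) :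
    0 ≤ S.mass G k i := by
  induction k using Nat.strong_induction_on generalizing i with
  | _ k ih =>
    rcases Nat.eq_zero_or_pos k with rfl | hk
    · rw [mass_zero]; positivity
    · rw [mass_pos_index S G hk]
      exact Finset.sum_nonneg fun s hs =>
        mul_nonneg (by positivity) (ih _ (Regular.sends_of_mem_buffer hs).2 _)

theorem share_nonneg (S : Schedule n) (G : Digraph (Fin n)) (k : ℕ) (i : Fin n) :
    0 ≤ S.share G k i :=
  mul_nonneg (by positivity) (mass_nonneg S G k i)

theorem sum_share (S : Schedule n) (G : Digraph (Fin n)) (k : ℕ) (i : Fin n) :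
    ∑ _i' ∈ outNbrs G i, S.share G k i = S.mass G k i := by
  have := card_outNbrs_pos G i
  rw [Finset.sum_const, nsmul_eq_mul, share, mul_inv_cancel_left₀ (by positivity)]

namespace Regular

variable {X : ℝ} {B K₀ : ℕ}

/-- An activated node sends out exactly the mass it receives, so the total keeps its initial value
`n * (1 / n)`. -/
theorem liveSum_share (h : S.Regular G X τlo B K₀) (k : ℕ) :
    S.liveSum G k (fun j p _ => S.share G p j) = 1 := by
  classical
  induction k with
  | zero =>
    have hn : (n : ℝ) ≠ 0 := by
      have i := (S.active_nonempty 1 le_rfl).some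
      have := i.pos
      positivity
    simp [h.liveSum_zero, sum_share, mass_zero, -Finset.sum_const]
    simp [hn]
  | succ k ih =>
    have := h.liveSum_succ k (fun j p _ => S.share G p j)
    rw [ih] at this
    refine add_right_cancel (this.trans ?_)
    congr 1
    refine Finset.sum_congr rfl fun i _ => ?_
    rw [sum_share, mass_pos_index S G (by omega)]
    rfl

open scoped Classical in
-- The messages broadcast at `k` are all still live after the updates at `k`, so they carry part of
-- the total mass 1.
theorem mass_le_one (h : S.Regular G X τlo B K₀) {k : ℕ} {i : Fin n} (hk : 1 ≤ k)
    (hik : i ∈ S.active k) : S.mass G k i ≤ 1 := by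
  obtain ⟨k, rfl⟩ : ∃ k', k = k' + 1 := ⟨k - 1, by omega⟩
  have h1 := h.liveSum_share (k + 1)
  rw [liveSum, Finset.sum_range_succ] at h1
  have hnn : ∀ p j i', 0 ≤ if S.Sends j p ∧ i' ∈ outNbrs G j ∧ k + 1 < S.use p j i' then
      S.share G p j else 0 := fun p j i' => by
    split_ifs
    · exact share_nonneg _ _ _ _
    · exact le_rfl
  have h2 : S.mass G (k + 1) i = ∑ i', if S.Sends i (k + 1) ∧ i' ∈ outNbrs G i ∧
      k + 1 < S.use (k + 1) i i' then S.share G (k + 1) i else 0 := by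
    have : ∀ j i, k + 1 < S.use (k + 1) j i := fun j i => (h.use_spec (k + 1) j i).1
    rw [← sum_share]
    simp [Sends, hik, this]
  have h3 := Finset.single_le_sum (f := fun j => ∑ i', if S.Sends j (k + 1) ∧
      i' ∈ outNbrs G j ∧ k + 1 < S.use (k + 1) j i' then S.share G (k + 1) j else 0)
    (fun j _ => Finset.sum_nonneg fun i' _ => hnn _ j i') (Finset.mem_univ i)
  have h4 : 0 ≤ ∑ p ∈ Finset.range (k + 1), ∑ j, ∑ i', if S.Sends j p ∧ i' ∈ outNbrs G j ∧
      k + 1 < S.use p j i' then S.share G p j else 0 :=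
    Finset.sum_nonneg fun p _ => Finset.sum_nonneg fun j _ => Finset.sum_nonneg fun i' _ =>
      hnn p j i'
  linarith

open scoped Classical in
/-- If every message that is live at cut `k` can reach the activation `(j, q)` in at most `L`
steps after its use, then this activation receives at least the fraction `n ^ (-L)` of the mass. -/
theorem le_mass (h : S.Regular G X τlo B K₀) {k q L : ℕ} {j : Fin n} (hkq : k < q)
    (hjq : j ∈ S.active q)
    (hreach : ∀ l p i, S.Sends l p → p ≤ k → i ∈ outNbrs G l → k < S.use p l i →
      ∃ s ≤ L, S.Chain G s (i, S.use p l i) (j, q)) :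
    ((n : ℝ)⁻¹) ^ L ≤ S.mass G q j := by
  have hn1 : (1 : ℝ) ≤ n := by exact_mod_cast j.pos
  have hn0 : (0 : ℝ) ≤ (n : ℝ)⁻¹ := by positivity
  have hn2 : (n : ℝ)⁻¹ ≤ 1 := inv_le_one_of_one_le₀ hn1
  -- With `s` the length of a shortest chain from `f` to `(j, q)`, the potential `n ^ (-s)` bounds
  -- from below the fraction of the mass at `f` that gets there. The live mass weighted by it does
  -- not decrease before `q`.
  let pot : Fin n × ℕ → ℝ := fun f =>
    if hf : ∃ s, S.Chain G s f (j, q) then ((n : ℝ)⁻¹) ^ Nat.find hf else 0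
  have hpot0 : ∀ f, 0 ≤ pot f := fun f => by
    simp only [pot]; split_ifs <;> positivity
  have hpot_ge : ∀ f s, S.Chain G s f (j, q) → ((n : ℝ)⁻¹) ^ s ≤ pot f := by
    intro f s hs
    have hf : ∃ s, S.Chain G s f (j, q) := ⟨s, hs⟩
    simp only [pot, dif_pos hf]
    exact pow_le_pow_of_le_one hn0 hn2 (Nat.find_min' hf hs)
  have hpot_le : ∀ f, pot f ≤ 1 := fun f => by
    simp only [pot]
    split_ifs
    · exact pow_le_one₀ hn0 hn2
    · exact zero_le_one
  have hmono : ∀ k' , k ≤ k' → k' < q →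
      ((n : ℝ)⁻¹) ^ L ≤ S.liveSum G k' (fun l p i => S.share G p l * pot (i, S.use p l i)) := by
    intro k' hk'
    induction k', hk' using Nat.le_induction with
    | base =>
      intro _
      rw [← mul_one (((n : ℝ)⁻¹) ^ L), ← h.liveSum_share k, mul_comm, ← smul_eq_mul,
        ← liveSum_smul]
      refine liveSum_mono fun l p i h1 h2 h3 h4 => ?_
      obtain ⟨s, hs, hc⟩ := hreach l p i h2 h1 h3 h4
      rw [smul_eq_mul]
      refine mul_le_mul_of_nonneg_left ?_ (share_nonneg _ _ _ _)
      exact (pow_le_pow_of_le_one hn0 hn2 hs).trans (hpot_ge _ _ hc)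
    | succ k' hk' ih =>
      intro hlt
      refine (ih (by omega)).trans ?_
      have hs := h.liveSum_succ k' (fun l p i => S.share G p l * pot (i, S.use p l i))
      suffices hle : ∑ i ∈ Finset.univ.filter (fun i => i ∈ S.active (k' + 1)),
          ∑ s ∈ S.buffer G i (k' + 1), S.share G s.2 s.1 * pot (i, S.use s.2 s.1 i) ≤
          ∑ i ∈ Finset.univ.filter (fun i => i ∈ S.active (k' + 1)),
          ∑ i' ∈ outNbrs G i, S.share G (k' + 1) i * pot (i', S.use (k' + 1) i i') by
        linarith
      refine Finset.sum_le_sum fun i hi => ?_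
      have hik := (Finset.mem_filter.1 hi).2
      have h1 : ∑ s ∈ S.buffer G i (k' + 1), S.share G s.2 s.1 * pot (i, S.use s.2 s.1 i) =
          S.mass G (k' + 1) i * pot (i, k' + 1) := by
        rw [mass_pos_index S G (by omega), Finset.sum_mul]
        refine Finset.sum_congr rfl fun s hs => ?_
        rw [((h.mem_buffer hik).1 (by simpa using hs)).2.2]
        rfl
      rw [h1, ← Finset.mul_sum, share, mul_comm (_ : ℝ)⁻¹, mul_assoc]
      refine mul_le_mul_of_nonneg_left ?_ (mass_nonneg _ _ _ _)
      -- The first message of a shortest chain takes at least `1 / n` of the mass and ends one step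
      -- closer, so the split does not lower the weighted mass.
      by_cases hf : ∃ s, S.Chain G s (i, k' + 1) (j, q)
      · have hfind := Nat.find_spec hf
        have hval : pot (i, k' + 1) = ((n : ℝ)⁻¹) ^ Nat.find hf := by simp only [pot, dif_pos hf]
        rw [hval]
        generalize Nat.find hf = s at hfind
        cases hfind with
        | nil => omega
        | @cons s r i' _ _ hi' hbuf hch =>
          have hm := (h.mem_buffer hi').1 hbuf
          have hc := card_outNbrs_pos G i
          have hc' : ((outNbrs G i).card : ℝ) ≤ n := by exact_mod_cast card_outNbrs_le G i
          have h2 : pot (i', S.use (k' + 1) i i') ≤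
              ∑ i' ∈ outNbrs G i, pot (i', S.use (k' + 1) i i') :=
            Finset.single_le_sum (f := fun i' => pot (i', S.use (k' + 1) i i'))
              (fun i' _ => hpot0 _) hm.1
          rw [pow_succ, mul_comm]
          have h3 : (n : ℝ)⁻¹ ≤ ((outNbrs G i).card : ℝ)⁻¹ := by gcongr
          refine mul_le_mul h3 (le_trans ?_ h2) (by positivity) (by positivity)
          rw [hm.2.2]
          exact hpot_ge _ _ hch
      · have hval : pot (i, k' + 1) = 0 := by simp only [pot, dif_neg hf]
        rw [hval]
        exact mul_nonneg (by positivity) (Finset.sum_nonneg fun _ _ => hpot0 _)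
  obtain ⟨q, rfl⟩ : ∃ q', q = q' + 1 := ⟨q - 1, by omega⟩
  refine (hmono q (by omega) (by omega)).trans ?_
  have hs := h.liveSum_succ q (fun l p i => S.share G p l * pot (i, S.use p l i))
  -- Indices increase along chains, so messages still live after the target have potential zero.
  -- Hence the weighted mass has all been used at this index, and by `j` alone.
  have hlate : S.liveSum G (q + 1) (fun l p i => S.share G p l * pot (i, S.use p l i)) ≤
      S.liveSum G (q + 1) (fun _ _ _ => 0) := by
    refine liveSum_mono fun l p i _ _ _ hlt => ?_
    have : ¬ ∃ s, S.Chain G s (i, S.use p l i) (j, q + 1) := by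
      rintro ⟨s, hch⟩
      have := hch.add_le
      simp only at this
      omega
    simp only [pot, dif_neg this, mul_zero, le_refl]
  have hzero : S.liveSum G (q + 1) (fun _ _ _ => (0 : ℝ)) = 0 := by simp [liveSum]
  have hnew : 0 ≤ ∑ i ∈ Finset.univ.filter (fun i => i ∈ S.active (q + 1)),
      ∑ i' ∈ outNbrs G i, S.share G (q + 1) i * pot (i', S.use (q + 1) i i') :=
    Finset.sum_nonneg fun i _ => Finset.sum_nonneg fun i' _ =>
      mul_nonneg (share_nonneg _ _ _ _) (hpot0 _)
  have hused : ∑ i ∈ Finset.univ.filter (fun i => i ∈ S.active (q + 1)),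
      ∑ s ∈ S.buffer G i (q + 1), S.share G s.2 s.1 * pot (i, S.use s.2 s.1 i) ≤
      S.mass G (q + 1) j := by
    rw [Finset.sum_eq_single_of_mem j (by simp [hjq])]
    · rw [mass_pos_index S G (by omega)]
      exact Finset.sum_le_sum fun s _ =>
        mul_le_of_le_one_right (share_nonneg _ _ _ _) (hpot_le _)
    · intro i hi hij
      have hik := (Finset.mem_filter.1 hi).2
      refine Finset.sum_eq_zero fun s hs => ?_
      rw [((h.mem_buffer hik).1 (by simpa using hs)).2.2]
      have : ¬ ∃ s, S.Chain G s (i, q + 1) (j, q + 1) := by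
        rintro ⟨s, hch⟩
        have hle := hch.add_le
        have hs0 : s = 0 := by simpa using hle
        subst hs0
        cases hch
        exact hij rfl
      simp only [pot, dif_neg this, mul_zero]
  linarith

theorem exists_le_mass (h : S.Regular G X τlo B K₀) (hG : StronglyConnected G) (hlo : 0 < τlo)
    (htime : ∀ a, ∃ k, a ≤ S.time k) {y : ℕ} (hy : X < y * τlo) :
    ∃ K₁, K₀ ≤ K₁ ∧ ∀ k j, K₁ < k → j ∈ S.active k →
      ((n : ℝ)⁻¹) ^ (diameter G + ((diameter G + 1) * y - 1)) ≤ S.mass G k j := by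
  -- The mass is traced back to the last cut `r` at least `(d + 1) X` earlier: one `X` for the
  -- messages in flight at `r` to be used, `d X` for a path from there to `j`.
  obtain ⟨K₁, hK₁⟩ := htime (S.time K₀ + (diameter G + 1) * X)
  have hX := h.X_pos
  have hdX : 0 < ((diameter G : ℝ) + 1) * X := by positivity
  refine ⟨K₁, S.time_strictMono.le_iff_le.1 (by linarith), fun k j hk hjk => ?_⟩
  have hlt := S.time_strictMono hk
  have hex : ∃ r, S.time k - (diameter G + 1) * X < S.time r := ⟨k, by linarith⟩
  classical
  have hfind := Nat.find_spec hex
  have hK₀ : K₀ < Nat.find hex := S.time_strictMono.lt_iff_lt.1 (by linarith)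
  have hk' : Nat.find hex ≤ k := Nat.find_min' hex (by linarith)
  obtain ⟨r, hr⟩ : ∃ r, Nat.find hex = r + 1 := ⟨Nat.find hex - 1, by omega⟩
  have hrt : S.time r ≤ S.time k - (diameter G + 1) * X := by
    have := Nat.find_min hex (m := r) (by omega)
    linarith
  rw [hr] at hfind hK₀ hk'
  refine h.le_mass (k := r) (by omega) hjk fun l p i hs hp hi hu => ?_
  obtain ⟨m, hm, hpath⟩ := exists_hasPath_le_diameter hG i j
  have hb := (h.use_bound p l i hs hi (by omega)).2
  have hpt := S.time_strictMono.monotone hp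
  have hmX : (m : ℝ) * X ≤ diameter G * X := by gcongr
  obtain ⟨w, hw, hwt⟩ := h.exists_chain_of_time hpath (by omega) (h.use_spec p l i).2.1 hjk
    (by linarith)
  refine ⟨m + w, ?_, hw⟩
  have hut := S.time_strictMono.monotone (show r + 1 ≤ S.use p l i by omega)
  -- The waiting messages fit into a time shorter than `(d + 1) X < (d + 1) y τlo`; strictness gives
  -- the `- 1` in the exponent.
  have h1 : (w : ℝ) * τlo < ((diameter G + 1) * y : ℕ) * τlo := by
    push_cast
    have : ((diameter G : ℝ) + 1) * X < (diameter G + 1) * (y * τlo) := by gcongr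
    linarith
  have h2 : w < (diameter G + 1) * y := by exact_mod_cast lt_of_mul_lt_mul_right h1 hlo.le
  omega

end Regular

end Schedule
end APPG

/-! ### Contraction of perturbed averaging -/

namespace APPG

namespace Schedule

variable {n : ℕ} {S : Schedule n} {G : Digraph (Fin n)} {τlo X : ℝ} {B K₀ : ℕ}

/-- The weights `w k i` are convex weights on the buffer of node `i`, bounded below by `ω`, at all
activations after `time K`. -/
def Averaging (S : Schedule n) (G : Digraph (Fin n)) (w : ℕ → Fin n → Fin n × ℕ → ℝ) (ω : ℝ)
    (K : ℕ) : Prop :=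
  ∀ k i, K < k → i ∈ S.active k →
    (∀ s ∈ S.buffer G i k, ω ≤ w k i s) ∧ ∑ s ∈ S.buffer G i k, w k i s = 1

namespace Averaging

variable {w : ℕ → Fin n → Fin n × ℕ → ℝ} {ω ε : ℝ} {φ : ℕ → Fin n → ℝ} {K K' T : ℕ}

theorem mono (hw : S.Averaging G w ω K) (hK : K ≤ K') : S.Averaging G w ω K' :=
  fun k i hk hi => hw k i (by omega) hi

theorem weaken {ω' : ℝ} (hw : S.Averaging G w ω K) (hω : ω' ≤ ω) : S.Averaging G w ω' K :=
  fun k i hk hi => ⟨fun s hs => hω.trans ((hw k i hk hi).1 s hs), (hw k i hk hi).2⟩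

/-- Messages used after `K` stem from the window beyond `K - B`, so induction applies to the whole
buffer, and each index costs one more `ε`. The truncated subtraction makes the correction vanish up
to `K`. -/
theorem superaverage_nonneg (h : S.Regular G X τlo B K₀) (hw : S.Averaging G w ω K) (hω : 0 ≤ ω)
    (hK : K₀ + B ≤ K) (hε : 0 ≤ ε)
    (hφ : ∀ k i, K < k → k ≤ K + T → i ∈ S.active k →
      ∑ s ∈ S.buffer G i k, w k i s * φ s.2 s.1 - ε ≤ φ k i)
    (h0 : ∀ k i, K < k + B → k ≤ K → i ∈ S.active k → 0 ≤ φ k i) :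
    ∀ k i, K < k + B → k ≤ K + T → i ∈ S.active k → 0 ≤ φ k i + (k - K : ℕ) * ε := by
  intro k
  induction k using Nat.strong_induction_on with
  | _ k ih =>
    intro i h1 h2 hik
    rcases le_or_gt k K with hk | hk
    · have := h0 k i h1 hk hik
      positivity
    · obtain ⟨hw1, hw2⟩ := hw k i hk hik
      have h4 : ∀ s ∈ S.buffer G i k, w k i s * (-((k - K - 1 : ℕ) * ε)) ≤ w k i s * φ s.2 s.1 := by
        intro s hs
        have hlt := (Regular.sends_of_mem_buffer (j := s.1) (p := s.2) hs)
        have hB := h.le_of_mem_buffer (by omega) hik hs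
        have h1 := h.one_le
        have := ih s.2 hlt.2 s.1 (by omega) (by omega) (hlt.1.resolve_left (by omega))
        refine mul_le_mul_of_nonneg_left ?_ (hω.trans (hw1 s hs))
        have h5 : ((s.2 - K : ℕ) : ℝ) * ε ≤ (k - K - 1 : ℕ) * ε := by
          have : s.2 - K ≤ k - K - 1 := by omega
          exact mul_le_mul_of_nonneg_right (by exact_mod_cast this) hε
        linarith
      have h5 := Finset.sum_le_sum h4
      rw [← Finset.sum_mul, hw2, one_mul] at h5
      have h6 : ((k - K : ℕ) : ℝ) = (k - K - 1 : ℕ) + 1 := by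
        exact_mod_cast (by omega : k - K = k - K - 1 + 1)
      have := hφ k i hk h2 hik
      rw [h6]
      linarith

/-- After the shift by the accumulated error all buffer terms are nonnegative, so all but the one on
the chain may be dropped; this costs a factor `ω` per message. -/
theorem superaverage_chain (h : S.Regular G X τlo B K₀) (hw : S.Averaging G w ω K) (hω : 0 ≤ ω)
    (hK : K₀ + B ≤ K) (hε : 0 ≤ ε)
    (hφ : ∀ k i, K < k → k ≤ K + T → i ∈ S.active k →
      ∑ s ∈ S.buffer G i k, w k i s * φ s.2 s.1 - ε ≤ φ k i)
    (h0 : ∀ k i, K < k + B → k ≤ K → i ∈ S.active k → 0 ≤ φ k i)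
    {s : ℕ} {f e : Fin n × ℕ} (hc : S.Chain G s f e) (hf : K ≤ f.2) (he : e.2 ≤ K + T) :
    ω ^ s * (φ f.2 f.1 + (f.2 - K : ℕ) * ε) ≤ φ e.2 e.1 + (e.2 - K : ℕ) * ε := by
  induction hc with
  | nil e => simp
  | @cons s k i f e hik hbuf hc ih =>
    have hkK := hc.add_le
    simp only at hkK
    have hlt := (Regular.sends_of_mem_buffer (j := f.1) (p := f.2) hbuf).2
    refine le_trans ?_ (ih (by simp only; omega) he)
    rw [pow_succ, mul_assoc]
    refine mul_le_mul_of_nonneg_left ?_ (by positivity)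
    simp only
    obtain ⟨hw1, hw2⟩ := hw k i (by omega) hik
    have hpos := superaverage_nonneg (T := T) h hw hω hK hε hφ h0
    have hsum : ∑ s ∈ S.buffer G i k, w k i s * (φ s.2 s.1 + (k - K - 1 : ℕ) * ε) =
        ∑ s ∈ S.buffer G i k, w k i s * φ s.2 s.1 + (k - K - 1 : ℕ) * ε := by
      simp only [mul_add, Finset.sum_add_distrib]
      rw [← Finset.sum_mul, hw2, one_mul]
    have hterm : ∀ s ∈ S.buffer G i k, φ s.2 s.1 + (s.2 - K : ℕ) * ε ≤
        φ s.2 s.1 + (k - K - 1 : ℕ) * ε ∧ 0 ≤ φ s.2 s.1 + (s.2 - K : ℕ) * ε := by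
      intro s hs
      have hls := Regular.sends_of_mem_buffer (j := s.1) (p := s.2) hs
      have hB := h.le_of_mem_buffer (by omega) hik hs
      have h1 := h.one_le
      constructor
      · have : s.2 - K ≤ k - K - 1 := by omega
        have := mul_le_mul_of_nonneg_right (Nat.cast_le (α := ℝ).2 this) hε
        linarith
      · exact hpos s.2 s.1 (by omega) (by omega) (hls.1.resolve_left (by omega))
    have h1 : ω * (φ f.2 f.1 + (f.2 - K : ℕ) * ε) ≤
        ∑ s ∈ S.buffer G i k, w k i s * (φ s.2 s.1 + (k - K - 1 : ℕ) * ε) := by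
      refine le_trans ?_ (Finset.single_le_sum (f := fun s => w k i s *
        (φ s.2 s.1 + (k - K - 1 : ℕ) * ε)) (fun s hs => mul_nonneg (hω.trans (hw1 s hs))
        ((hterm s hs).2.trans (hterm s hs).1)) hbuf)
      exact mul_le_mul (hw1 f hbuf) (hterm f hbuf).1 (hterm f hbuf).2 (hω.trans (hw1 f hbuf))
    have h6 : ((k - K : ℕ) : ℝ) = (k - K - 1 : ℕ) + 1 := by
      exact_mod_cast (by omega : k - K = k - K - 1 + 1)
    have := hφ k i (by omega) (by omega) hik
    rw [h6]
    linarith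

/-- A quantity that is at least its weighted average, up to `ε`, keeps the fraction `ω ^ T` of any
value it takes at an activation that reaches the activation considered. -/
theorem superaverage_le (h : S.Regular G X τlo B K₀) (hw : S.Averaging G w ω K) (hω : 0 ≤ ω)
    (hω1 : ω ≤ 1) (hK : K₀ + B ≤ K) (hε : 0 ≤ ε)
    (hφ : ∀ k i, K < k → k ≤ K + T → i ∈ S.active k →
      ∑ s ∈ S.buffer G i k, w k i s * φ s.2 s.1 - ε ≤ φ k i)
    (h0 : ∀ k i, K < k + B → k ≤ K → i ∈ S.active k → 0 ≤ φ k i)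
    {s : ℕ} {f e : Fin n × ℕ} (hc : S.Chain G s f e) (hf : K ≤ f.2) (he : e.2 ≤ K + T)
    {a : ℝ} (ha : 0 ≤ a) (haf : a ≤ φ f.2 f.1 + (f.2 - K : ℕ) * ε) :
    ω ^ T * a ≤ φ e.2 e.1 + T * ε := by
  have h1 := superaverage_chain h hw hω hK hε hφ h0 hc hf he
  have hs : s ≤ T := by have := hc.add_le; omega
  have h2 : ω ^ T * a ≤ ω ^ s * (φ f.2 f.1 + (f.2 - K : ℕ) * ε) :=
    mul_le_mul (pow_le_pow_of_le_one hω hω1 hs) haf ha (by positivity)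
  have h3 : ((e.2 - K : ℕ) : ℝ) * ε ≤ T * ε := by
    gcongr
    omega
  linarith

theorem norm_sum_sub_le {E : Type*} [NormedAddCommGroup E] [NormedSpace ℝ E]
    (hw : S.Averaging G w ω K) (hω : 0 ≤ ω) {k : ℕ} {i : Fin n} (hk : K < k)
    (hik : i ∈ S.active k) {z : Fin n × ℕ → E} {c : E} {D : ℝ}
    (hz : ∀ s ∈ S.buffer G i k, ‖z s - c‖ ≤ D) :
    ‖∑ s ∈ S.buffer G i k, w k i s • z s - c‖ ≤ D := by
  obtain ⟨hw1, hw2⟩ := hw k i hk hik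
  have := (convex_closedBall c D).sum_mem (fun s hs => hω.trans (hw1 s hs)) hw2
    (z := z) (fun s hs => by simpa [dist_eq_norm] using hz s hs)
  simpa [dist_eq_norm] using this

/-- Averaging contracts the spread of vectors. -/
theorem consensus {E : Type*} [NormedAddCommGroup E] [InnerProductSpace ℝ E]
    (h : S.Regular G X τlo B K₀) (hG : StronglyConnected G) (hw : S.Averaging G w ω K)
    (hω : 0 ≤ ω) (hω1 : ω ≤ 1) (hK : K₀ + B ≤ K) (hB : 1 ≤ B)
    (hT : T = (diameter G + 3) * B) {z : ℕ → Fin n → E} {D : ℝ} (hε : 0 ≤ ε)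
    (hz : ∀ k i, K < k → k ≤ K + T → i ∈ S.active k →
      ‖z k i - ∑ s ∈ S.buffer G i k, w k i s • z s.2 s.1‖ ≤ ε)
    (h0 : ∀ k i k' i', K < k + 2 * B → k ≤ K → i ∈ S.active k → K < k' + 2 * B → k' ≤ K →
      i' ∈ S.active k' → ‖z k i - z k' i'‖ ≤ D) :
    ∀ k i k' i', K + T < k + 2 * B → k ≤ K + T → i ∈ S.active k → K + T < k' + 2 * B →
      k' ≤ K + T → i' ∈ S.active k' →
      ‖z k i - z k' i'‖ ≤ (1 - ω ^ T) * D + 2 * (T * ε) := by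
  classical
  intro k₁ i₁ k₂ i₂ h1 h2 h3 h1' h2' h3'
  have hone := h.one_le
  obtain ⟨i₀, hi₀⟩ := S.active_nonempty K (by omega)
  -- Testing with the difference to be bounded reduces the claim to scalars: the square of its norm
  -- is a difference of two values of the functional `inner ℝ v`.
  set v := z k₁ i₁ - z k₂ i₂ with hv
  let W : Finset (Fin n × ℕ) := (Finset.univ ×ˢ Finset.range (K + 1)).filter
    fun e => K < e.2 + 2 * B ∧ e.1 ∈ S.active e.2
  have hW : ∀ k i, K < k + 2 * B → k ≤ K → i ∈ S.active k → (i, k) ∈ W := fun k i h4 h5 h6 => by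
    simp only [W, Finset.mem_filter, Finset.mem_product, Finset.mem_univ, Finset.mem_range,
      true_and]
    exact ⟨by omega, h4, h6⟩
  have hW' : ∀ e ∈ W, K < e.2 + 2 * B ∧ e.2 ≤ K ∧ e.1 ∈ S.active e.2 := fun e he => by
    simp only [W, Finset.mem_filter, Finset.mem_product, Finset.mem_univ, Finset.mem_range,
      true_and] at he
    exact ⟨he.2.1, by omega, he.2.2⟩
  have hne : W.Nonempty := ⟨(i₀, K), hW K i₀ (by omega) le_rfl hi₀⟩
  obtain ⟨a, ha, hamax⟩ := Finset.exists_max_image W (fun e => inner ℝ v (z e.2 e.1)) hne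
  obtain ⟨b, hb, hbmin⟩ := Finset.exists_min_image W (fun e => inner ℝ v (z e.2 e.1)) hne
  have hTB : T = diameter G * B + 3 * B := by rw [hT]; ring
  have hchain : ∀ j k, K + T < k + 2 * B → j ∈ S.active k → ∃ s, S.Chain G s (i₀, K) (j, k) := by
    intro j k hk hj
    obtain ⟨l, hl, hp⟩ := exists_hasPath_le_diameter hG i₀ j
    have : l * B ≤ diameter G * B := Nat.mul_le_mul_right _ hl
    exact h.exists_chain hp (by omega) hi₀ hj (by omega)
  have hstep : ∀ k i, K < k → k ≤ K + T → i ∈ S.active k →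
      |inner ℝ v (z k i) - ∑ s ∈ S.buffer G i k, w k i s * inner ℝ v (z s.2 s.1)| ≤ ‖v‖ * ε := by
    intro k i h4 h5 h6
    have : inner ℝ v (z k i) - ∑ s ∈ S.buffer G i k, w k i s * inner ℝ v (z s.2 s.1) =
        inner ℝ v (z k i - ∑ s ∈ S.buffer G i k, w k i s • z s.2 s.1) := by
      simp [inner_sub_right, inner_sum, inner_smul_right]
    rw [this]
    exact (abs_real_inner_le_norm _ _).trans
      (mul_le_mul_of_nonneg_left (hz k i h4 h5 h6) (norm_nonneg _))
  have hε' : 0 ≤ ‖v‖ * ε := by positivity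
  have hm0 : inner ℝ v (z K i₀) ≤ inner ℝ v (z a.2 a.1) := hamax _ (hW K i₀ (by omega) le_rfl hi₀)
  have hm1 : inner ℝ v (z b.2 b.1) ≤ inner ℝ v (z K i₀) := hbmin _ (hW K i₀ (by omega) le_rfl hi₀)
  obtain ⟨s₁, hs₁⟩ := hchain i₁ k₁ h1 h3
  obtain ⟨s₂, hs₂⟩ := hchain i₂ k₂ h1' h3'
  -- Distance below the maximum and distance above the minimum over the window are both
  -- superaverages. Started at the same activation `(i₀, K)`, their initial values add up to the
  -- whole range, so the two bounds together shrink it by `1 - ω ^ T`.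
  have hup := superaverage_le (T := T) (φ := fun k i => inner ℝ v (z a.2 a.1) - inner ℝ v (z k i))
    (a := inner ℝ v (z a.2 a.1) - inner ℝ v (z K i₀)) h hw hω hω1 hK hε' (by
      intro k i h4 h5 h6
      have := (abs_le.1 (hstep k i h4 h5 h6)).2
      simp only [mul_sub, Finset.sum_sub_distrib]
      rw [← Finset.sum_mul, (hw k i h4 h6).2]
      linarith) (by
      intro k i h4 h5 h6
      have := hamax _ (hW k i (by omega) h5 h6)
      simp only at this ⊢
      linarith) hs₁ le_rfl h2 (by linarith) (by simp)
  have hlow := superaverage_le (T := T) (φ := fun k i => inner ℝ v (z k i) - inner ℝ v (z b.2 b.1))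
    (a := inner ℝ v (z K i₀) - inner ℝ v (z b.2 b.1)) h hw hω hω1 hK hε' (by
      intro k i h4 h5 h6
      have := (abs_le.1 (hstep k i h4 h5 h6)).1
      simp only [mul_sub, Finset.sum_sub_distrib]
      rw [← Finset.sum_mul, (hw k i h4 h6).2]
      linarith) (by
      intro k i h4 h5 h6
      have := hbmin _ (hW k i (by omega) h5 h6)
      simp only at this ⊢
      linarith) hs₂ le_rfl h2' (by linarith) (by simp)
  simp only at hup hlow
  have hab : inner ℝ v (z a.2 a.1) - inner ℝ v (z b.2 b.1) ≤ ‖v‖ * D := by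
    rw [← inner_sub_right]
    obtain ⟨ha1, ha2, ha3⟩ := hW' a ha
    obtain ⟨hb1, hb2, hb3⟩ := hW' b hb
    exact (real_inner_le_norm _ _).trans
      (mul_le_mul_of_nonneg_left (h0 _ _ _ _ ha1 ha2 ha3 hb1 hb2 hb3) (norm_nonneg _))
  have hvv : ‖v‖ * ‖v‖ = inner ℝ v (z k₁ i₁) - inner ℝ v (z k₂ i₂) := by
    rw [← inner_sub_right, ← hv, real_inner_self_eq_norm_mul_norm]
  have hκ : ω ^ T ≤ 1 := pow_le_one₀ hω hω1
  have hfinal : ‖v‖ * ‖v‖ ≤ ‖v‖ * ((1 - ω ^ T) * D + 2 * (T * ε)) := by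
    have h7 := mul_le_mul_of_nonneg_left hab (sub_nonneg.2 hκ)
    linarith
  rcases (norm_nonneg v).eq_or_lt with hv0 | hv0
  · rw [← hv0]
    have hD : 0 ≤ D := (norm_nonneg _).trans
      (h0 K i₀ K i₀ (by omega) le_rfl hi₀ (by omega) le_rfl hi₀)
    have := mul_nonneg (sub_nonneg.2 hκ) hD
    positivity
  · exact le_of_mul_le_mul_left hfinal hv0

end Averaging
end Schedule

/-! ### Smooth functions without convexity -/

section Smooth

variable {E : Type*} [NormedAddCommGroup E] [InnerProductSpace ℝ E] [CompleteSpace E]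
  {β : ℝ} {h : E → ℝ}

/-- Mean value inequality on the segment for `h` minus its linear part at `u`, whose gradient has
norm at most `β * ‖v - u‖` there. The sharper constant `β / 2` is not needed. -/
theorem LipschitzSmooth.abs_sub_le (hh : LipschitzSmooth β h) (hβ : 0 ≤ β) (u v : E) :
    |h v - h u - inner ℝ (gradient h u) (v - u)| ≤ β * ‖v - u‖ ^ 2 := by
  let g : E → ℝ := fun x => h x - inner ℝ (gradient h u) x
  have hg : ∀ x, HasFDerivAt g (innerSL ℝ (gradient h x - gradient h u)) x := by
    intro x
    have h1 := (hh.1 x).hasGradientAt.hasFDerivAt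
    have h2 := (innerSL ℝ (gradient h u)).hasFDerivAt (x := x)
    refine (h1.sub h2).congr_fderiv ?_
    ext y
    simp
  have := (convex_segment u v).norm_image_sub_le_of_norm_hasFDerivWithin_le
    (f := g) (f' := fun x => innerSL ℝ (gradient h x - gradient h u)) (C := β * ‖v - u‖)
    (fun x _ => (hg x).hasFDerivWithinAt) (fun x hx => by
      rw [innerSL_apply_norm]
      refine (hh.2 x u).trans (mul_le_mul_of_nonneg_left ?_ hβ)
      obtain ⟨t, ht, rfl⟩ := (segment_eq_image' ℝ u v).subset hx
      rw [add_sub_cancel_left, norm_smul, Real.norm_of_nonneg ht.1]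
      exact mul_le_of_le_one_left (norm_nonneg _) ht.2) (left_mem_segment ℝ u v)
      (right_mem_segment ℝ u v)
  rw [Real.norm_eq_abs] at this
  simp only [g] at this
  rw [inner_sub_right]
  calc _ = |h v - inner ℝ (gradient h u) v - (h u - inner ℝ (gradient h u) u)| := by
        congr 1; ring
    _ ≤ _ := this.trans (by rw [pow_two, mul_assoc])

/-- A gradient step of length `1 / (2 β)` cannot lead below `b`. -/
theorem LipschitzSmooth.norm_gradient_sq_le (hh : LipschitzSmooth β h) (hβ : 0 < β) {b : ℝ}
    (hb : ∀ v, b ≤ h v) (u : E) : ‖gradient h u‖ ^ 2 ≤ 4 * β * (h u - b) := by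
  have h1 := (abs_le.1 (hh.abs_sub_le hβ.le u (u - (2 * β)⁻¹ • gradient h u))).2
  have h2 := hb (u - (2 * β)⁻¹ • gradient h u)
  rw [sub_sub_cancel_left, inner_neg_right, inner_smul_right, real_inner_self_eq_norm_sq,
    norm_neg, norm_smul, Real.norm_of_nonneg (by positivity)] at h1
  have h3 : β * ((2 * β)⁻¹ * ‖gradient h u‖) ^ 2 = (4 * β)⁻¹ * ‖gradient h u‖ ^ 2 := by
    field_simp; ring
  have h4 : (2 * β)⁻¹ * ‖gradient h u‖ ^ 2 = 2 * ((4 * β)⁻¹ * ‖gradient h u‖ ^ 2) := by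
    field_simp; ring
  rw [h3, h4] at h1
  have h5 : (4 * β)⁻¹ * ‖gradient h u‖ ^ 2 ≤ h u - b := by linarith
  rwa [inv_mul_le_iff₀ (by positivity)] at h5

/-- Substitute for Jensen's inequality: in an expansion around the mean the first-order terms
cancel, and the remainder is quadratic in the spread, hence of second order in the stepsize. -/
theorem LipschitzSmooth.map_sum_le (hh : LipschitzSmooth β h) (hβ : 0 ≤ β) {ι : Type*}
    {t : Finset ι} {w : ι → ℝ} {z : ι → E} (hw : ∀ s ∈ t, 0 ≤ w s) (hw1 : ∑ s ∈ t, w s = 1) {D : ℝ}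
    (hD : ∀ s ∈ t, ‖z s - ∑ r ∈ t, w r • z r‖ ≤ D) :
    h (∑ s ∈ t, w s • z s) ≤ ∑ s ∈ t, w s * h (z s) + β * D ^ 2 := by
  set c := ∑ s ∈ t, w s • z s with hc
  have h1 : ∀ s ∈ t, w s * (h c + inner ℝ (gradient h c) (z s - c) - β * D ^ 2) ≤
      w s * h (z s) := by
    intro s hs
    refine mul_le_mul_of_nonneg_left ?_ (hw s hs)
    have h2 := (abs_le.1 (hh.abs_sub_le hβ c (z s))).1
    have h3 : ‖z s - c‖ ^ 2 ≤ D ^ 2 := by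
      have := hD s hs
      gcongr
    have h4 := mul_le_mul_of_nonneg_left h3 hβ
    linarith
  have h2 : ∑ s ∈ t, w s * (h c + inner ℝ (gradient h c) (z s - c) - β * D ^ 2) =
      h c - β * D ^ 2 := by
    have h3 : ∑ s ∈ t, w s * inner ℝ (gradient h c) (z s - c) = 0 := by
      simp only [← inner_smul_right, ← inner_sum, smul_sub, Finset.sum_sub_distrib]
      rw [← Finset.sum_smul, hw1, one_smul, ← hc, sub_self, inner_zero_right]
    have h4 : ∀ s, w s * (h c + inner ℝ (gradient h c) (z s - c) - β * D ^ 2) =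
        w s * (h c - β * D ^ 2) + w s * inner ℝ (gradient h c) (z s - c) := fun s => by ring
    simp only [h4, Finset.sum_add_distrib, h3, ← Finset.sum_mul, hw1]
    ring
  have := Finset.sum_le_sum h1
  linarith

theorem LipschitzSmooth.continuous (hh : LipschitzSmooth β h) : Continuous h :=
  hh.1.continuous

theorem gradient_fun_sum {n : ℕ} {f : Fin n → E → ℝ} (hf : ∀ i, LipschitzSmooth β (f i)) (u : E) :
    gradient (fun v => ∑ i, f i v) u = ∑ i, gradient (f i) u := by
  refine HasGradientAt.gradient ?_
  rw [hasGradientAt_iff_hasFDerivAt, map_sum]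
  exact HasFDerivAt.fun_sum fun i _ => ((hf i).1 u).hasGradientAt.hasFDerivAt

theorem lipschitzSmooth_sum {n : ℕ} {f : Fin n → E → ℝ} (hf : ∀ i, LipschitzSmooth β (f i)) :
    LipschitzSmooth (n * β) (fun v => ∑ i, f i v) := by
  refine ⟨fun u => (DifferentiableAt.fun_sum fun i _ => (hf i).1 u), fun u v => ?_⟩
  rw [gradient_fun_sum hf, gradient_fun_sum hf, ← Finset.sum_sub_distrib]
  refine (norm_sum_le _ _).trans ?_
  refine (Finset.sum_le_sum fun i _ => (hf i).2 u v).trans ?_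
  simp [mul_assoc]

end Smooth
end APPG

/-! ### The two averaging processes of an execution -/

namespace APPG

namespace Schedule

variable {n : ℕ} {S : Schedule n} {G : Digraph (Fin n)} {τlo X θ : ℝ} {B K₀ : ℕ}

theorem Regular.mono (h : S.Regular G X τlo B K₀) {K : ℕ} (hK : K₀ ≤ K) :
    S.Regular G X τlo B K where
  one_le := h.one_le.trans hK
  X_pos := h.X_pos
  separated := h.separated
  exists_active i k hk := h.exists_active i k (hK.trans hk)
  use_spec := h.use_spec
  use_bound p j i h1 h2 h3 := h.use_bound p j i h1 h2 (hK.trans_lt h3)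

/-- The uniform weights on the buffer. -/
noncomputable def bufferWeight (S : Schedule n) (G : Digraph (Fin n)) (k : ℕ) (i : Fin n)
    (_ : Fin n × ℕ) : ℝ :=
  ((S.buffer G i k).card : ℝ)⁻¹

/-- The weights with which the ratios of `y` and the push-sum mass are averaged. -/
noncomputable def massWeight (S : Schedule n) (G : Digraph (Fin n)) (k : ℕ) (i : Fin n)
    (s : Fin n × ℕ) : ℝ :=
  (S.mass G k i)⁻¹ * S.share G s.2 s.1

/-- The buffer holds at most one message per sender and index, all from the last `B` indices. -/
theorem Regular.averaging_bufferWeight (h : S.Regular G X τlo B K₀) :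
    S.Averaging G (S.bufferWeight G) ((n * B : ℕ) : ℝ)⁻¹ K₀ := by
  intro k i hk hik
  obtain ⟨p, hp, -⟩ := h.exists_self_mem_buffer (by omega) hik
  have hpos : 0 < (S.buffer G i k).card := Finset.card_pos.2 ⟨_, hp⟩
  constructor
  · intro s _
    have hsub : S.buffer G i k ⊆ Finset.univ ×ˢ Finset.Ico (k - B) k := by
      intro s hs
      have h1 := (Regular.sends_of_mem_buffer (j := s.1) (p := s.2) hs).2
      have h2 := h.le_of_mem_buffer hk hik hs
      simp only [Finset.mem_product, Finset.mem_univ, Finset.mem_Ico, true_and]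
      omega
    have hcard := Finset.card_le_card hsub
    rw [Finset.card_product, Finset.card_univ, Fintype.card_fin, Nat.card_Ico] at hcard
    have : (S.buffer G i k).card ≤ n * B := hcard.trans (Nat.mul_le_mul_left _ (by omega))
    unfold bufferWeight
    gcongr
  · simp only [bufferWeight, Finset.sum_const, nsmul_eq_mul]
    exact mul_inv_cancel₀ (by positivity)

/-- The mass of an activation is the sum of the shares it uses, so the weights add up to 1. Each
share is at least `θ / n`, and division by a mass at most 1 does not lower it. -/
theorem Regular.averaging_massWeight (h : S.Regular G X τlo B K₀) (hθ : 0 < θ)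
    (hmass : ∀ k i, K₀ < k → i ∈ S.active k → θ ≤ S.mass G k i) :
    S.Averaging G (S.massWeight G) ((n : ℝ)⁻¹ * θ) (K₀ + B) := by
  intro k i hk hik
  have hone := h.one_le
  have hm := hmass k i (by omega) hik
  have hm0 : 0 < S.mass G k i := hθ.trans_le hm
  have hm1 := h.mass_le_one (by omega) hik
  constructor
  · intro s hs
    have h1 := Regular.sends_of_mem_buffer (j := s.1) (p := s.2) hs
    have h2 := h.le_of_mem_buffer (by omega) hik hs
    have h3 := hmass s.2 s.1 (by omega) (h1.1.resolve_left (by omega))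
    have h4 := card_outNbrs_pos G s.1
    have h5 : ((outNbrs G s.1).card : ℝ) ≤ n := by exact_mod_cast card_outNbrs_le G s.1
    have h6 : (n : ℝ)⁻¹ * θ ≤ S.share G s.2 s.1 := by
      unfold share
      gcongr
    refine h6.trans (le_mul_of_one_le_left (share_nonneg _ _ _ _) ?_)
    exact (one_le_inv₀ hm0).2 hm1
  · simp only [massWeight, ← Finset.mul_sum]
    have : ∑ s ∈ S.buffer G i k, S.share G s.2 s.1 = S.mass G k i :=
      (mass_pos_index S G (by omega) i).symm
    rw [this, inv_mul_cancel₀ hm0.ne']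

/-- The values of `z` at the activations with index in `(K - 2 B, b]` differ by at most `D`. -/
def Spread {E : Type*} [SeminormedAddCommGroup E] (S : Schedule n) (B : ℕ) (z : ℕ → Fin n → E)
    (K b : ℕ) (D : ℝ) : Prop :=
  ∀ k i k' i', K < k + 2 * B → k ≤ b → i ∈ S.active k → K < k' + 2 * B → k' ≤ b →
    i' ∈ S.active k' → ‖z k i - z k' i'‖ ≤ D

variable {E : Type*} [NormedAddCommGroup E]

theorem Spread.weaken {z : ℕ → Fin n → E} {K b : ℕ} {D D' : ℝ} (h : S.Spread B z K b D)
    (hD : D ≤ D') : S.Spread B z K b D' :=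
  fun k i k' i' h1 h2 h3 h4 h5 h6 => (h k i k' i' h1 h2 h3 h4 h5 h6).trans hD

theorem Spread.shrink {z : ℕ → Fin n → E} {K b b' : ℕ} {D : ℝ} (h : S.Spread B z K b D)
    (hb : b' ≤ b) : S.Spread B z K b' D :=
  fun k i k' i' h1 h2 h3 h4 h5 h6 => h k i k' i' h1 (h2.trans hb) h3 h4 (h5.trans hb) h6

/-- Averages stay in every ball containing the averaged points. Two nodes may be activated at the
same index, each with its own perturbation, hence `2 * ε`. -/
theorem Spread.succ [NormedSpace ℝ E] {z : ℕ → Fin n → E} {K k : ℕ} {D ε ω : ℝ}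
    {w : ℕ → Fin n → Fin n × ℕ → ℝ}
    (hz : S.Spread B z K k D) (h : S.Regular G X τlo B K₀) (hw : S.Averaging G w ω K) (hω : 0 ≤ ω)
    (hK : K₀ + 2 * B ≤ K) (hk : K ≤ k) (hε : 0 ≤ ε)
    (hstep : ∀ i ∈ S.active (k + 1),
      ‖z (k + 1) i - ∑ s ∈ S.buffer G i (k + 1), w (k + 1) i s • z s.2 s.1‖ ≤ ε) :
    S.Spread B z K (k + 1) (D + 2 * ε) := by
  have hone := h.one_le
  have hbuf : ∀ i ∈ S.active (k + 1), ∀ s ∈ S.buffer G i (k + 1),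
      K < s.2 + 2 * B ∧ s.2 ≤ k ∧ s.1 ∈ S.active s.2 := by
    intro i hi s hs
    have h1 := Regular.sends_of_mem_buffer (j := s.1) (p := s.2) hs
    have h2 := h.le_of_mem_buffer (by omega) hi hs
    exact ⟨by omega, by omega, h1.1.resolve_left (by omega)⟩
  have hold : ∀ i ∈ S.active (k + 1), ∀ k' i', K < k' + 2 * B → k' ≤ k → i' ∈ S.active k' →
      ‖∑ s ∈ S.buffer G i (k + 1), w (k + 1) i s • z s.2 s.1 - z k' i'‖ ≤ D := by
    intro i hi k' i' h1 h2 h3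
    refine hw.norm_sum_sub_le hω (by omega) hi (z := fun s => z s.2 s.1) fun s hs => ?_
    obtain ⟨h4, h5, h6⟩ := hbuf i hi s hs
    exact hz _ _ _ _ h4 h5 h6 h1 h2 h3
  have hnew : ∀ i ∈ S.active (k + 1), ∀ k' i', K < k' + 2 * B → k' ≤ k → i' ∈ S.active k' →
      ‖z (k + 1) i - z k' i'‖ ≤ D + ε := by
    intro i hi k' i' h1 h2 h3
    have := norm_add_le (z (k + 1) i - ∑ s ∈ S.buffer G i (k + 1), w (k + 1) i s • z s.2 s.1)
      (∑ s ∈ S.buffer G i (k + 1), w (k + 1) i s • z s.2 s.1 - z k' i')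
    rw [sub_add_sub_cancel] at this
    linarith [hstep i hi, hold i hi k' i' h1 h2 h3]
  intro k₁ i₁ k₂ i₂ h1 h2 h3 h4 h5 h6
  rcases h2.lt_or_eq with h2 | rfl <;> rcases h5.lt_or_eq with h5 | rfl
  · linarith [hz k₁ i₁ k₂ i₂ h1 (by omega) h3 h4 (by omega) h6]
  · rw [norm_sub_rev]
    linarith [hnew i₂ h6 k₁ i₁ h1 (by omega) h3]
  · linarith [hnew i₁ h3 k₂ i₂ h4 (by omega) h6]
  · have h7 : ‖∑ s ∈ S.buffer G i₂ (k + 1), w (k + 1) i₂ s • z s.2 s.1 - z (k + 1) i₁‖ ≤ D + ε :=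
      hw.norm_sum_sub_le hω (by omega) h6 (z := fun s => z s.2 s.1) fun s hs => by
        obtain ⟨h7, h8, h9⟩ := hbuf i₂ h6 s hs
        rw [norm_sub_rev]
        exact hnew i₁ h3 s.2 s.1 h7 h8 h9
    have := norm_add_le (z (k + 1) i₂ - ∑ s ∈ S.buffer G i₂ (k + 1), w (k + 1) i₂ s • z s.2 s.1)
      (∑ s ∈ S.buffer G i₂ (k + 1), w (k + 1) i₂ s • z s.2 s.1 - z (k + 1) i₁)
    rw [sub_add_sub_cancel] at this
    rw [norm_sub_rev]
    linarith [hstep i₂ h6]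

end Schedule

namespace IsExecution

variable {n : ℕ} {E : Type*} [NormedAddCommGroup E] [InnerProductSpace ℝ E] [CompleteSpace E]
  {G : Digraph (Fin n)} {f : Fin n → E → ℝ} {γ : Fin n → ℝ} {S : Schedule n} {R : Trajectory n E}
  {τlo X θ : ℝ} {B K₀ : ℕ}

theorem g_eq (hR : IsExecution G f γ S R) (k : ℕ) (i : Fin n) :
    R.g k i = gradient (f i) (R.x k i) := by
  induction k with
  | zero => exact hR.init_g i
  | succ k ih =>
    by_cases hi : i ∈ S.active (k + 1)
    · exact hR.step_g k i hi
    · obtain ⟨h1, -, h3, -⟩ := hR.idle k i hi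
      rw [h1, h3, ih]

theorem yt_eq (hR : IsExecution G f γ S R) {k : ℕ} {i : Fin n} (hs : S.Sends i k) :
    R.yt k i = ((outNbrs G i).card : ℝ)⁻¹ • R.y k i := by
  rcases Nat.eq_zero_or_pos k with rfl | hk
  · exact hR.init_yt i
  · obtain ⟨k, rfl⟩ : ∃ k', k = k' + 1 := ⟨k - 1, by omega⟩
    exact hR.step_yt k i (hs.resolve_left (by omega))

/-- Gradient tracking: a node passes on all it receives and adds the increment of its gradient. -/
theorem liveSum_yt (hR : IsExecution G f γ S R) (h : S.Regular G X τlo B K₀) (k : ℕ) :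
    S.liveSum G k (fun j p _ => ((outNbrs G j).card : ℝ)⁻¹ • R.y p j) = ∑ i, R.g k i := by
  classical
  have hsum : ∀ p j, ∑ _i ∈ outNbrs G j, ((outNbrs G j).card : ℝ)⁻¹ • R.y p j = R.y p j := by
    intro p j
    have := Schedule.card_outNbrs_pos G j
    rw [Finset.sum_const, ← Nat.cast_smul_eq_nsmul ℝ, smul_smul, mul_inv_cancel₀ (by positivity),
      one_smul]
  induction k with
  | zero =>
    rw [h.liveSum_zero]
    exact Finset.sum_congr rfl fun i _ => (hsum 0 i).trans (hR.init_y i)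
  | succ k ih =>
    have hs := h.liveSum_succ k (fun j p _ => ((outNbrs G j).card : ℝ)⁻¹ • R.y p j)
    rw [ih] at hs
    refine add_right_cancel (hs.trans ?_)
    have h1 : ∑ i, R.g (k + 1) i = ∑ i, R.g k i +
        ∑ i ∈ Finset.univ.filter (fun i => i ∈ S.active (k + 1)), (R.g (k + 1) i - R.g k i) := by
      rw [Finset.sum_filter, ← Finset.sum_add_distrib]
      refine Finset.sum_congr rfl fun i _ => ?_
      split_ifs with hi
      · abel
      · rw [add_zero, (hR.idle k i hi).2.2.1]
    rw [h1, add_assoc, ← Finset.sum_add_distrib]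
    congr 1
    refine Finset.sum_congr rfl fun i hi => ?_
    rw [hsum, hR.step_y k i (Finset.mem_filter.1 hi).2]
    have : ∑ s ∈ S.buffer G i (k + 1), R.yt s.2 s.1 =
        ∑ s ∈ S.buffer G i (k + 1), ((outNbrs G s.1).card : ℝ)⁻¹ • R.y s.2 s.1 :=
      Finset.sum_congr rfl fun s hs =>
        hR.yt_eq (Schedule.Regular.sends_of_mem_buffer (j := s.1) (p := s.2) hs).1
    rw [this]
    abel

theorem x_eq (hR : IsExecution G f γ S R) {k : ℕ} {i : Fin n} (hk : 1 ≤ k)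
    (hi : i ∈ S.active k) :
    R.x k i = ∑ s ∈ S.buffer G i k, S.bufferWeight G k i s • R.xt s.2 s.1 := by
  obtain ⟨k, rfl⟩ : ∃ k', k = k' + 1 := ⟨k - 1, by omega⟩
  rw [hR.step_x k i hi, Finset.smul_sum]
  rfl

theorem xt_eq (hR : IsExecution G f γ S R) {k : ℕ} {i : Fin n} (hk : 1 ≤ k)
    (hi : i ∈ S.active k) : R.xt k i = R.x k i - γ i • R.y k i := by
  obtain ⟨k, rfl⟩ : ∃ k', k = k' + 1 := ⟨k - 1, by omega⟩
  exact hR.step_xt k i hi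

theorem exists_last (hR : IsExecution G f γ S R) (h : S.Regular G X τlo B K₀) {k : ℕ}
    (hk : K₀ + B ≤ k) (i : Fin n) :
    ∃ k', k < k' + B ∧ k' ≤ k ∧ i ∈ S.active k' ∧ R.x k i = R.x k' i ∧ R.y k i = R.y k' i := by
  have hone := h.one_le
  obtain ⟨q, h1, h2, h3⟩ := h.exists_active i (k - B) (by omega)
  obtain ⟨r, h4, h5, h6, h7⟩ :=
    Schedule.exists_last_active (S := S) i (k + 1) ⟨q, by omega, by omega, h3⟩
  have hqr : q ≤ r := by
    by_contra hlt
    exact h7 q (by omega) (by omega) h3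
  refine ⟨r, by omega, by omega, h6, ?_⟩
  have : ∀ m, r ≤ m → m ≤ k → R.x m i = R.x r i ∧ R.y m i = R.y r i := by
    intro m hm
    induction m, hm using Nat.le_induction with
    | base => exact fun _ => ⟨rfl, rfl⟩
    | succ m hm ih =>
      intro hmk
      obtain ⟨e1, e2, -⟩ := hR.idle m i (h7 (m + 1) (by omega) (by omega))
      rw [e1, e2]
      exact ih (by omega)
  exact this k (by omega) le_rfl

/-- The state at `k` dates from an activation less than `B` iterations back, whose messages are at
most `B` older; this is why the window of `Spread` has length `2 * B`. -/
theorem norm_x_sub_le (hR : IsExecution G f γ S R) (h : S.Regular G X τlo B K₀) {K k : ℕ}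
    (hK : K₀ + 2 * B ≤ K) (hk : K ≤ k) (i : Fin n) {c : E} {D : ℝ}
    (hc : ∀ p j, K < p + 2 * B → p < k → j ∈ S.active p → ‖R.xt p j - c‖ ≤ D) :
    ‖R.x k i - c‖ ≤ D := by
  have hone := h.one_le
  obtain ⟨k', h1, h2, h3, h4, -⟩ := hR.exists_last h (k := k) (by omega) i
  rw [h4, hR.x_eq (by omega) h3]
  refine h.averaging_bufferWeight.norm_sum_sub_le (by positivity) (by omega) h3
    (z := fun s => R.xt s.2 s.1) fun s hs => ?_
  have h5 := Schedule.Regular.sends_of_mem_buffer (j := s.1) (p := s.2) hs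
  have h6 := h.le_of_mem_buffer (by omega) h3 hs
  exact hc _ _ (by omega) (by omega) (h5.1.resolve_left (by omega))

theorem norm_x_sub_x_le (hR : IsExecution G f γ S R) (h : S.Regular G X τlo B K₀) {K k k' : ℕ}
    (hK : K₀ + 2 * B ≤ K) (hk : K ≤ k) (hk' : K ≤ k') (i i' : Fin n) {D : ℝ} {b : ℕ}
    (hb : k ≤ b + 1) (hb' : k' ≤ b + 1)
    (hD : S.Spread B R.xt K b D) : ‖R.x k i - R.x k' i'‖ ≤ D := by
  refine hR.norm_x_sub_le h hK hk i fun p j h1 h2 h3 => ?_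
  rw [norm_sub_rev]
  refine hR.norm_x_sub_le h hK hk' i' fun p' j' h1' h2' h3' => ?_
  exact hD _ _ _ _ h1' (by omega) h3' h1 (by omega) h3

end IsExecution

/-- The ratio of `y` and the push-sum mass. -/
noncomputable def Trajectory.ratio {n : ℕ} {E : Type*} [AddCommGroup E] [Module ℝ E]
    (R : Trajectory n E) (S : Schedule n) (G : Digraph (Fin n)) (k : ℕ) (i : Fin n) : E :=
  (S.mass G k i)⁻¹ • R.y k i

/-- The standing assumptions of the convergence analysis: the timing is regular and the push-sum
mass is at least `θ` after `time K₀`. -/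
structure Setting {n : ℕ} {E : Type*} [NormedAddCommGroup E] [InnerProductSpace ℝ E]
    [CompleteSpace E] (G : Digraph (Fin n)) (f : Fin n → E → ℝ) (γ : Fin n → ℝ) (S : Schedule n)
    (R : Trajectory n E) (X τlo α β θ step b : ℝ) (B K₀ : ℕ) : Prop where
  connected : StronglyConnected G
  execution : IsExecution G f γ S R
  regular : S.Regular G X τlo B K₀
  one_le_B : 1 ≤ B
  θ_pos : 0 < θ
  α_pos : 0 < α
  β_pos : 0 < β
  mass_ge : ∀ k i, K₀ < k → i ∈ S.active k → θ ≤ S.mass G k i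
  smooth : ∀ i, LipschitzSmooth β (f i)
  step_pos : ∀ i, 0 < γ i
  step_le : ∀ i, γ i ≤ step
  bound : ∀ u, b ≤ ∑ i, f i u
  dominated : ∀ u, 2 * α * (∑ i, f i u - b) ≤ ‖gradient (fun v => ∑ i, f i v) u‖ ^ 2

namespace Setting

variable {n : ℕ} {E : Type*} [NormedAddCommGroup E] [InnerProductSpace ℝ E] [CompleteSpace E]
  {G : Digraph (Fin n)} {f : Fin n → E → ℝ} {γ : Fin n → ℝ} {S : Schedule n} {R : Trajectory n E}
  {X τlo α β θ step b : ℝ} {B K₀ : ℕ}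

theorem mass_pos (H : Setting G f γ S R X τlo α β θ step b B K₀) {k : ℕ} {i : Fin n} (hk : K₀ < k)
    (hi : i ∈ S.active k) : 0 < S.mass G k i :=
  H.θ_pos.trans_le (H.mass_ge k i hk hi)

theorem y_eq (H : Setting G f γ S R X τlo α β θ step b B K₀) {k : ℕ} {i : Fin n} (hk : K₀ < k)
    (hi : i ∈ S.active k) : R.y k i = S.mass G k i • R.ratio S G k i := by
  rw [Trajectory.ratio, smul_smul, mul_inv_cancel₀ (H.mass_pos hk hi).ne', one_smul]

theorem norm_y_le (H : Setting G f γ S R X τlo α β θ step b B K₀) {k : ℕ} {i : Fin n} (hk : K₀ < k)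
    (hi : i ∈ S.active k) : ‖R.y k i‖ ≤ ‖R.ratio S G k i‖ := by
  rw [H.y_eq hk hi, norm_smul, Real.norm_of_nonneg (H.mass_pos hk hi).le]
  exact mul_le_of_le_one_left (norm_nonneg _)
    (H.regular.mass_le_one (H.regular.one_le.trans hk.le) hi)

theorem share_smul_ratio (H : Setting G f γ S R X τlo α β θ step b B K₀) {k : ℕ} {i : Fin n}
    (hk : K₀ < k) (hi : i ∈ S.active k) :
    S.share G k i • R.ratio S G k i = ((outNbrs G i).card : ℝ)⁻¹ • R.y k i := by
  rw [H.y_eq hk hi, smul_smul]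
  rfl

theorem ratio_step (H : Setting G f γ S R X τlo α β θ step b B K₀) {k : ℕ} {i : Fin n}
    (hk : K₀ + B ≤ k) (hi : i ∈ S.active (k + 1)) :
    R.ratio S G (k + 1) i -
      ∑ s ∈ S.buffer G i (k + 1), S.massWeight G (k + 1) i s • R.ratio S G s.2 s.1 =
    (S.mass G (k + 1) i)⁻¹ • (R.g (k + 1) i - R.g k i) := by
  have hone := H.regular.one_le
  have : ∑ s ∈ S.buffer G i (k + 1), S.massWeight G (k + 1) i s • R.ratio S G s.2 s.1 =
      (S.mass G (k + 1) i)⁻¹ • ∑ s ∈ S.buffer G i (k + 1), R.yt s.2 s.1 := by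
    rw [Finset.smul_sum]
    refine Finset.sum_congr rfl fun s hs => ?_
    have h1 := Schedule.Regular.sends_of_mem_buffer (j := s.1) (p := s.2) hs
    have h2 := H.regular.le_of_mem_buffer (by omega) hi hs
    rw [Schedule.massWeight, mul_smul,
      H.share_smul_ratio (by omega) (h1.1.resolve_left (by omega)), H.execution.yt_eq h1.1]
  rw [this, Trajectory.ratio, ← smul_sub, H.execution.step_y k i hi]
  congr 1
  abel

/-- The perturbation is a gradient increment between two states of one node, divided by a mass at
least `θ`; both states are averages of broadcast points from the window. -/
theorem norm_ratio_step_le (H : Setting G f γ S R X τlo α β θ step b B K₀) {K k : ℕ} {i : Fin n}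
    (hK : K₀ + 2 * B ≤ K) (hk : K ≤ k) (hi : i ∈ S.active (k + 1)) {D : ℝ}
    (hD : S.Spread B R.xt K k D) :
    ‖R.ratio S G (k + 1) i -
      ∑ s ∈ S.buffer G i (k + 1), S.massWeight G (k + 1) i s • R.ratio S G s.2 s.1‖ ≤
    β * D / θ := by
  have hθ := H.θ_pos
  have hm := H.mass_ge (k + 1) i (by omega) hi
  rw [H.ratio_step (by omega) hi, norm_smul, norm_inv,
    Real.norm_of_nonneg (H.mass_pos (by omega) hi).le, H.execution.g_eq, H.execution.g_eq,
    div_eq_inv_mul]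
  have h1 := (H.smooth i).2 (R.x (k + 1) i) (R.x k i)
  have h2 := H.execution.norm_x_sub_x_le H.regular hK (k := k + 1) (k' := k) (by omega) hk i i
    (b := k) le_rfl (by omega) hD
  have h3 := mul_le_mul_of_nonneg_left h2 H.β_pos.le
  gcongr
  exact h1.trans h3

/-- The sum of the gradients is the convex combination, with the live shares as weights, of the
ratios of the messages in flight. -/
theorem norm_ratio_sub_le (H : Setting G f γ S R X τlo α β θ step b B K₀) {K k : ℕ} {i : Fin n}
    (hK : K₀ + 2 * B ≤ K) (hk : K ≤ k) (hi : i ∈ S.active k) {D : ℝ}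
    (hD : S.Spread B (R.ratio S G) K k D) :
    ‖R.ratio S G k i - ∑ l, gradient (f l) (R.x k l)‖ ≤ D := by
  have hone := H.regular.one_le
  have hB := H.one_le_B
  have hlive : ∀ j p i', p ≤ k → S.Sends j p → i' ∈ outNbrs G j → k < S.use p j i' →
      k < p + B ∧ j ∈ S.active p := by
    intro j p i' h1 h2 h3 h4
    have := (H.regular.use_bound p j i' h2 h3 (by omega)).1
    exact ⟨by omega, h2.resolve_left (by omega)⟩
  have h1 : ∑ l, gradient (f l) (R.x k l) =
      S.liveSum G k (fun j p _ => S.share G p j • R.ratio S G p j) := by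
    simp only [← H.execution.g_eq]
    rw [← H.execution.liveSum_yt H.regular]
    unfold Schedule.liveSum
    refine Finset.sum_congr rfl fun p hp => Finset.sum_congr rfl fun j _ =>
      Finset.sum_congr rfl fun i' _ => ?_
    split_ifs with hc
    · obtain ⟨h2, h3⟩ := hlive j p i' (by simpa [Nat.lt_succ_iff] using hp) hc.1 hc.2.1 hc.2.2
      exact (H.share_smul_ratio (by omega) h3).symm
    · rfl
  have h2 : R.ratio S G k i =
      S.liveSum G k (fun j p _ => S.share G p j • R.ratio S G k i) := by
    rw [Schedule.liveSum_smul, H.regular.liveSum_share, one_smul]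
  rw [h1, h2, ← Schedule.liveSum_sub]
  have h3 : S.liveSum G k (fun j p _ => S.share G p j * D) = D := by
    have := Schedule.liveSum_smul (S := S) (G := G) (k := k) (fun j p _ => S.share G p j) D
    simp only [smul_eq_mul] at this
    rw [this, H.regular.liveSum_share, one_mul]
  refine (Schedule.norm_liveSum_le (ψ := fun j p _ => S.share G p j * D)
    fun j p i' h4 h5 h6 h7 => ?_).trans h3.le
  obtain ⟨h8, h9⟩ := hlive j p i' h4 h5 h6 h7
  rw [← smul_sub, norm_smul, Real.norm_of_nonneg (Schedule.share_nonneg _ _ _ _)]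
  exact mul_le_mul_of_nonneg_left (hD _ _ _ _ (by omega) le_rfl hi (by omega) h4 h9)
    (Schedule.share_nonneg _ _ _ _)

theorem norm_sum_gradient_sub_le (H : Setting G f γ S R X τlo α β θ step b B K₀) {k : ℕ} {c : E}
    {D : ℝ} (hc : ∀ l, ‖R.x k l - c‖ ≤ D) :
    ‖∑ l, gradient (f l) (R.x k l) - gradient (fun v => ∑ l, f l v) c‖ ≤ n * β * D := by
  rw [gradient_fun_sum H.smooth, ← Finset.sum_sub_distrib]
  refine (norm_sum_le _ _).trans ((Finset.sum_le_sum fun l _ =>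
    ((H.smooth l).2 _ _).trans (mul_le_mul_of_nonneg_left (hc l) H.β_pos.le)).trans ?_)
  simp [mul_assoc]

end Setting
end APPG

/-! ### Growth of the spreads and descent within `T` iterations -/

namespace APPG
namespace Setting

variable {n : ℕ} {E : Type*} [NormedAddCommGroup E] [InnerProductSpace ℝ E] [CompleteSpace E]
  {G : Digraph (Fin n)} {f : Fin n → E → ℝ} {γ : Fin n → ℝ} {S : Schedule n} {R : Trajectory n E}
  {X τlo α β θ step b ψ g A A' c : ℝ} {B K₀ K T : ℕ}

theorem step_nonneg (H : Setting G f γ S R X τlo α β θ step b B K₀) : 0 ≤ step := by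
  obtain ⟨i, _⟩ := S.active_nonempty 1 le_rfl
  exact (H.step_pos i).le.trans (H.step_le i)

/-- A bound on the ratio at an activation in terms of the spreads and of one reference gradient. -/
theorem norm_ratio_le (H : Setting G f γ S R X τlo α β θ step b B K₀) {k : ℕ} {i : Fin n}
    (hK : K₀ + 2 * B ≤ K) (hk : K ≤ k) (hi : i ∈ S.active (k + 1)) {D D' : ℝ}
    (hD : S.Spread B R.xt K k D) (hD' : S.Spread B (R.ratio S G) K (k + 1) D') {i₀ : Fin n}
    (hi₀ : i₀ ∈ S.active K) :
    ‖R.ratio S G (k + 1) i‖ ≤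
      D' + n * β * D + ‖gradient (fun v => ∑ l, f l v) (R.xt K i₀)‖ := by
  have hB := H.one_le_B
  have h1 := H.norm_ratio_sub_le hK (k := k + 1) (by omega) hi hD'
  have h2 := H.norm_sum_gradient_sub_le (k := k + 1) (c := R.xt K i₀) (D := D) fun l =>
    H.execution.norm_x_sub_le H.regular hK (by omega) l fun p j h3 h4 h5 =>
      hD _ _ _ _ h3 (by omega) h5 (by omega) hk hi₀
  have h3 := norm_add₃_le (a := R.ratio S G (k + 1) i - ∑ l, gradient (f l) (R.x (k + 1) l))
    (b := ∑ l, gradient (f l) (R.x (k + 1) l) - gradient (fun v => ∑ l, f l v) (R.xt K i₀))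
    (c := gradient (fun v => ∑ l, f l v) (R.xt K i₀))
  have h4 : R.ratio S G (k + 1) i - ∑ l, gradient (f l) (R.x (k + 1) l) +
    (∑ l, gradient (f l) (R.x (k + 1) l) - gradient (fun v => ∑ l, f l v) (R.xt K i₀)) +
    gradient (fun v => ∑ l, f l v) (R.xt K i₀) = R.ratio S G (k + 1) i := by abel
  rw [h4] at h3
  linarith

/-- The spreads stay of the order of the stepsize during `T` iterations. -/
theorem spread_growth (H : Setting G f γ S R X τlo α β θ step b B K₀)
    (hK : K₀ + 2 * B ≤ K) (hψ : 0 ≤ ψ) (hg : 0 ≤ g) (hc : 0 ≤ c)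
    (hcβ : β * (A + 2 * T * (g + 1)) / θ ≤ c)
    (hsmall : (A' + 2 * T * c + n * β * (A + 2 * T * (g + 1))) * step ≤ 1)
    {i₀ : Fin n} (hi₀ : i₀ ∈ S.active K)
    (hgrad : ‖gradient (fun v => ∑ l, f l v) (R.xt K i₀)‖ ≤ g * ψ)
    (hx : S.Spread B R.xt K K (A * step * ψ))
    (hr : S.Spread B (R.ratio S G) K K (A' * step * ψ)) :
    ∀ m ≤ T, S.Spread B R.xt K (K + m) ((A + 2 * m * (g + 1)) * step * ψ) ∧
      S.Spread B (R.ratio S G) K (K + m) ((A' + 2 * m * c) * step * ψ) := by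
  have hs := H.step_nonneg
  have hβ := H.β_pos
  have hθ := H.θ_pos
  have hone := H.regular.one_le
  have hB := H.one_le_B
  intro m
  induction m with
  | zero => intro _; simpa using ⟨hx, hr⟩
  | succ m ih =>
    intro hm
    obtain ⟨hx', hr'⟩ := ih (by omega)
    have hmT : (m : ℝ) + 1 ≤ T := by exact_mod_cast hm
    have hX : (A + 2 * m * (g + 1)) * step * ψ ≤ (A + 2 * T * (g + 1)) * step * ψ := by
      gcongr; linarith
    have hrstep : ∀ i ∈ S.active (K + m + 1), ‖R.ratio S G (K + m + 1) i -
        ∑ s ∈ S.buffer G i (K + m + 1), S.massWeight G (K + m + 1) i s • R.ratio S G s.2 s.1‖ ≤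
        c * step * ψ := by
      intro i hi
      refine (H.norm_ratio_step_le hK (by omega) hi (hx'.weaken hX)).trans ?_
      calc β * ((A + 2 * T * (g + 1)) * step * ψ) / θ
          = (β * (A + 2 * T * (g + 1)) / θ) * (step * ψ) := by ring
        _ ≤ c * (step * ψ) := by gcongr
        _ = _ := by ring
    -- The ratios are advanced first: the new `xt` depends on the new `y`, whose bound needs the
    -- spread of the ratios up to the new index.
    have hr1 : S.Spread B (R.ratio S G) K (K + (m + 1))
        ((A' + 2 * (m + 1 : ℕ) * c) * step * ψ) := by
      have := hr'.succ (w := S.massWeight G) H.regular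
        ((H.regular.averaging_massWeight H.θ_pos H.mass_ge).mono (K' := K) (by omega))
        (by positivity) hK (by omega) (by positivity) hrstep
      refine this.weaken (le_of_eq ?_)
      push_cast; ring
    refine ⟨?_, hr1⟩
    have hxstep : ∀ i ∈ S.active (K + m + 1), ‖R.xt (K + m + 1) i -
        ∑ s ∈ S.buffer G i (K + m + 1), S.bufferWeight G (K + m + 1) i s • R.xt s.2 s.1‖ ≤
        (g + 1) * step * ψ := by
      intro i hi
      rw [← H.execution.x_eq (by omega) hi, H.execution.xt_eq (by omega) hi, sub_sub_cancel_left,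
        norm_neg, norm_smul, Real.norm_of_nonneg (H.step_pos i).le]
      have h1 := H.norm_ratio_le hK (by omega) hi (hx'.weaken hX) hr1 hi₀
      -- For a small stepsize the spreads add at most `ψ` to the reference gradient, which is at
      -- most `g * ψ`; hence the factor `g + 1`.
      have h2 : (A' + 2 * (m + 1 : ℕ) * c) * step * ψ +
          n * β * ((A + 2 * T * (g + 1)) * step * ψ) ≤ 1 * ψ := by
        refine le_trans ?_ (mul_le_mul_of_nonneg_right hsmall hψ)
        have : (A' + 2 * (m + 1 : ℕ) * c) * step * ψ ≤ (A' + 2 * T * c) * step * ψ := by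
          push_cast
          gcongr
        linarith
      have h3 : ‖R.y (K + m + 1) i‖ ≤ (g + 1) * ψ :=
        (H.norm_y_le (by omega) hi).trans (by linarith)
      calc γ i * ‖R.y (K + m + 1) i‖ ≤ step * ((g + 1) * ψ) := by
            have := H.step_le i
            gcongr
        _ = _ := by ring
    have := hx'.succ (w := S.bufferWeight G) H.regular
      (H.regular.averaging_bufferWeight.mono (K' := K) (by omega))
      (by positivity) hK (by omega) (by positivity) hxstep
    refine this.weaken (le_of_eq ?_)
    push_cast; ring

/-- The bounds which hold at an activation after `time K` when the spreads up to it are of the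
order of the stepsize. -/
theorem descent (H : Setting G f γ S R X τlo α β θ step b B K₀)
    (hK : K₀ + 2 * B ≤ K) (hψ : 0 ≤ ψ) (hA : 0 ≤ A) (hA' : 0 ≤ A') (hg : 0 ≤ g)
    (hsmall : (A' + n * β * A) * step ≤ 1)
    {i₀ : Fin n} (hi₀ : i₀ ∈ S.active K)
    (hgrad : ‖gradient (fun v => ∑ l, f l v) (R.xt K i₀)‖ ≤ g * ψ) {k : ℕ} (hk : K < k)
    (hx : S.Spread B R.xt K k (A * step * ψ))
    (hr : S.Spread B (R.ratio S G) K k (A' * step * ψ)) {i : Fin n} (hi : i ∈ S.active k)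
    (hstep : 2 * α * θ * γ i ≤ 1) :
    ‖R.y k i‖ ≤ (g + 1) * ψ ∧
    ∑ l, f l (R.xt k i) - b ≤ (1 - 2 * α * θ * γ i) *
      ∑ s ∈ S.buffer G i k, S.bufferWeight G k i s * (∑ l, f l (R.xt s.2 s.1) - b) +
      ((g + 1) * (A' + n * β * A) + n * β * (g + 1) ^ 2 + n * β * A ^ 2) * step ^ 2 * ψ ^ 2 := by
  have hs := H.step_nonneg
  have hβ := H.β_pos
  have hα := H.α_pos
  have hθ := H.θ_pos
  have hone := H.regular.one_le
  have hB := H.one_le_B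
  have hγ := H.step_pos i
  have hγs := H.step_le i
  obtain ⟨k, rfl⟩ : ∃ k', k = k' + 1 := ⟨k - 1, by omega⟩
  have hsm : (A' * step * ψ) + n * β * (A * step * ψ) ≤ ψ := by
    have := mul_le_mul_of_nonneg_right hsmall hψ
    linarith
  have hrat := H.norm_ratio_le hK (by omega) hi (hx.shrink (Nat.le_succ k)) hr hi₀
  have hrat' : ‖R.ratio S G (k + 1) i‖ ≤ (g + 1) * ψ := by linarith
  have hy : ‖R.y (k + 1) i‖ ≤ (g + 1) * ψ := (H.norm_y_le (by omega) hi).trans hrat'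
  refine ⟨hy, ?_⟩
  set F : E → ℝ := fun v => ∑ l, f l v with hF
  have hFs : LipschitzSmooth (n * β) F := lipschitzSmooth_sum H.smooth
  set x := R.x (k + 1) i with hxdef
  set r := R.ratio S G (k + 1) i with hrdef
  have hxc : ‖x - R.xt K i₀‖ ≤ A * step * ψ :=
    H.execution.norm_x_sub_le H.regular hK (by omega) i fun p j h3 h4 h5 =>
      hx _ _ _ _ h3 (by omega) h5 (by omega) (by omega) hi₀
  have hgx : ‖gradient F x‖ ≤ (g + 1) * ψ := by
    have h1 := hFs.2 x (R.xt K i₀)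
    have h2 := norm_add_le (gradient F x - gradient F (R.xt K i₀)) (gradient F (R.xt K i₀))
    rw [sub_add_cancel] at h2
    have h3 : n * β * ‖x - R.xt K i₀‖ ≤ n * β * (A * step * ψ) := by gcongr
    have h4 : 0 ≤ A' * step * ψ := by positivity
    linarith
  have hη : ‖r - gradient F x‖ ≤ (A' + n * β * A) * step * ψ := by
    have h1 := H.norm_ratio_sub_le hK (k := k + 1) (by omega) hi hr
    have h2 := H.norm_sum_gradient_sub_le (k := k + 1) (c := x) (D := A * step * ψ) fun l =>
      H.execution.norm_x_sub_x_le H.regular hK (by omega) (by omega) l i (Nat.le_succ _)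
        (Nat.le_succ _) hx
    have h3 := norm_add_le (r - ∑ l, gradient (f l) (R.x (k + 1) l))
      (∑ l, gradient (f l) (R.x (k + 1) l) - gradient F x)
    rw [sub_add_sub_cancel] at h3
    linarith
  have hxavg : x = ∑ s ∈ S.buffer G i (k + 1), S.bufferWeight G (k + 1) i s • R.xt s.2 s.1 :=
    H.execution.x_eq (by omega) hi
  obtain ⟨hw1, hw2⟩ := H.regular.averaging_bufferWeight (k + 1) i (by omega) hi
  have hFx : F x - b ≤ ∑ s ∈ S.buffer G i (k + 1), S.bufferWeight G (k + 1) i s *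
      (F (R.xt s.2 s.1) - b) + n * β * (A * step * ψ) ^ 2 := by
    have h1 := hFs.map_sum_le (by positivity) (t := S.buffer G i (k + 1))
      (w := S.bufferWeight G (k + 1) i) (z := fun s => R.xt s.2 s.1)
      (fun s hs => le_trans (by positivity) (hw1 s hs)) hw2 (D := A * step * ψ) (by
        intro s hs
        rw [← hxavg, norm_sub_rev]
        have h5 := Schedule.Regular.sends_of_mem_buffer (j := s.1) (p := s.2) hs
        have h6 := H.regular.le_of_mem_buffer (by omega) hi hs
        exact H.execution.norm_x_sub_le H.regular hK (by omega) i fun p j h3 h4 h5' =>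
          hx _ _ _ _ h3 (by omega) h5' (by omega) (by omega) (h5.1.resolve_left (by omega)))
    rw [← hxavg] at h1
    simp only [mul_sub, Finset.sum_sub_distrib]
    rw [← Finset.sum_mul, hw2]
    linarith
  have hxt : R.xt (k + 1) i - x = -(γ i • (S.mass G (k + 1) i • r)) := by
    rw [H.execution.xt_eq (by omega) hi, H.y_eq (by omega) hi, sub_sub_cancel_left]
  have hdesc := (abs_le.1 (hFs.abs_sub_le (by positivity) x (R.xt (k + 1) i))).2
  have hnorm : ‖R.xt (k + 1) i - x‖ ≤ step * ((g + 1) * ψ) := by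
    rw [hxt, norm_neg, norm_smul, Real.norm_of_nonneg hγ.le, ← H.y_eq (by omega) hi]
    gcongr
  have hnorm2 : n * β * ‖R.xt (k + 1) i - x‖ ^ 2 ≤ n * β * (step * ((g + 1) * ψ)) ^ 2 := by gcongr
  have hm := H.mass_ge (k + 1) i (by omega) hi
  have hm1 := H.regular.mass_le_one (by omega) hi
  -- The movement is `-γ i` times the mass times `r`. The mass is at least `θ`, which keeps the main
  -- term, and at most 1, which does not enlarge the tracking error.
  have hinner : inner ℝ (gradient F x) (R.xt (k + 1) i - x) ≤
      -(γ i * θ * ‖gradient F x‖ ^ 2) + step * ((g + 1) * ψ * ((A' + n * β * A) * step * ψ)) := by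
    rw [hxt, inner_neg_right, inner_smul_right, inner_smul_right]
    have h1 : inner ℝ (gradient F x) r =
        ‖gradient F x‖ ^ 2 + inner ℝ (gradient F x) (r - gradient F x) := by
      rw [inner_sub_right, real_inner_self_eq_norm_sq]; ring
    have h2 : -((g + 1) * ψ * ((A' + n * β * A) * step * ψ)) ≤
        inner ℝ (gradient F x) (r - gradient F x) := by
      refine (neg_le_neg ?_).trans (neg_le_of_abs_le (abs_real_inner_le_norm _ _))
      gcongr
    have h3 : θ * ‖gradient F x‖ ^ 2 ≤ S.mass G (k + 1) i * ‖gradient F x‖ ^ 2 := by gcongr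
    set e := (g + 1) * ψ * ((A' + n * β * A) * step * ψ) with he
    have he0 : 0 ≤ e := by positivity
    have h4 : θ * ‖gradient F x‖ ^ 2 - e ≤ S.mass G (k + 1) i * inner ℝ (gradient F x) r := by
      rw [h1, mul_add]
      have h5 := mul_le_mul_of_nonneg_left h2 (hθ.le.trans hm)
      have h6 := mul_le_of_le_one_left he0 hm1
      linarith
    have h5 := mul_le_mul_of_nonneg_left h4 hγ.le
    have h6 := mul_le_mul_of_nonneg_right hγs he0
    linarith
  have hPL := H.dominated x
  have hPL' : γ i * θ * (2 * α * (F x - b)) ≤ γ i * θ * ‖gradient F x‖ ^ 2 := by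
    have h1 : 0 ≤ γ i * θ := by positivity
    exact mul_le_mul_of_nonneg_left hPL h1
  have hq0 : 0 ≤ 1 - 2 * α * θ * γ i := by linarith
  have hq1 : 1 - 2 * α * θ * γ i ≤ 1 := by
    have : 0 < 2 * α * θ * γ i := by positivity
    linarith
  have h1 := mul_le_mul_of_nonneg_left hFx hq0
  have h2 : (1 - 2 * α * θ * γ i) * (n * β * (A * step * ψ) ^ 2) ≤
      n * β * (A * step * ψ) ^ 2 := mul_le_of_le_one_left (by positivity) hq1
  change F (R.xt (k + 1) i) - b ≤ (1 - 2 * α * θ * γ i) *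
    ∑ s ∈ S.buffer G i (k + 1), S.bufferWeight G (k + 1) i s * (F (R.xt s.2 s.1) - b) + _
  linarith

end Setting
end APPG

/-! ### Contraction of the optimality gap -/

namespace APPG

/-- The state around `time K` is of size `ψ`: the optimality gaps are at most `ψ ^ 2`, and the
spreads are at most `ψ` times the stepsize times a constant. -/
structure Close {n : ℕ} {E : Type*} [NormedAddCommGroup E] [InnerProductSpace ℝ E]
    (G : Digraph (Fin n)) (f : Fin n → E → ℝ) (S : Schedule n) (R : Trajectory n E)
    (step b A A' : ℝ) (B K : ℕ) (ψ : ℝ) : Prop where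
  gap : ∀ k i, K < k + B → k ≤ K → i ∈ S.active k → ∑ l, f l (R.xt k i) - b ≤ ψ ^ 2
  spread_xt : S.Spread B R.xt K K (A * step * ψ)
  spread_ratio : S.Spread B (R.ratio S G) K K (A' * step * ψ)

namespace Setting

variable {n : ℕ} {E : Type*} [NormedAddCommGroup E] [InnerProductSpace ℝ E] [CompleteSpace E]
  {G : Digraph (Fin n)} {f : Fin n → E → ℝ} {γ : Fin n → ℝ} {S : Schedule n} {R : Trajectory n E}
  {X τlo α β θ step b ψ g A A' c C κ γlo : ℝ} {B K₀ K T : ℕ}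

/-- Contraction of the optimality gap when all stepsizes are comparable. -/
theorem gap_of_comparable (H : Setting G f γ S R X τlo α β θ step b B K₀) {m₀ : ℕ}
    (hK : K₀ + 2 * B ≤ K) (hlo : 0 < γlo) (hγlo : ∀ i, γlo ≤ γ i)
    (h0 : ∀ k i, K < k + B → k ≤ K → i ∈ S.active k → ∑ l, f l (R.xt k i) - b ≤ ψ ^ 2)
    (hdesc : ∀ k i, K < k → k ≤ K + T → i ∈ S.active k → ∑ l, f l (R.xt k i) - b ≤
      (1 - 2 * α * θ * γ i) * ∑ s ∈ S.buffer G i k, S.bufferWeight G k i s *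
        (∑ l, f l (R.xt s.2 s.1) - b) + C * step ^ 2 * ψ ^ 2)
    (hC : C * step ^ 2 ≤ α * θ * γlo / 2) (hm₀ : 4 * m₀ * (α * θ * step) ≤ 1)
    (hm₀1 : 1 ≤ m₀) :
    ∀ k i m, m ≤ m₀ → K + m * B < k + B → k ≤ K + T → i ∈ S.active k →
      ∑ l, f l (R.xt k i) - b ≤ (1 - m * (α * θ * γlo)) * ψ ^ 2 := by
  have hα := H.α_pos
  have hθ := H.θ_pos
  have hone := H.regular.one_le
  have hB := H.one_le_B
  set a := α * θ * γlo with ha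
  have ha0 : 0 < a := by positivity
  have has : a ≤ α * θ * step := by
    obtain ⟨i, _⟩ := S.active_nonempty 1 le_rfl
    have := (hγlo i).trans (H.step_le i)
    rw [ha]; gcongr
  intro k
  induction k using Nat.strong_induction_on with
  | _ k ih =>
    intro i m hm hkm hkT hik
    -- Messages are at most `B` old, so an activation at stage `m + 1` uses only messages obeying
    -- the bound of stage `m`: each block of `B` iterations gains one `a`.
    have main : ∀ m, 1 ≤ m → m ≤ m₀ → K + m * B < k + B →
        ∑ l, f l (R.xt k i) - b ≤ (1 - m * a) * ψ ^ 2 := by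
      intro m hm1 hm hkm
      obtain ⟨m, rfl⟩ : ∃ m', m = m' + 1 := ⟨m - 1, by omega⟩
      rw [Nat.succ_mul] at hkm
      have hKk : K < k := by
        have : 0 ≤ m * B := Nat.zero_le _
        omega
      obtain ⟨hw1, hw2⟩ := H.regular.averaging_bufferWeight k i (by omega) hik
      have hw0 : ∀ s ∈ S.buffer G i k, 0 ≤ S.bufferWeight G k i s := fun s hs =>
        le_trans (by positivity) (hw1 s hs)
      have havg0 : 0 ≤ ∑ s ∈ S.buffer G i k, S.bufferWeight G k i s *
          (∑ l, f l (R.xt s.2 s.1) - b) :=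
        Finset.sum_nonneg fun s hs => mul_nonneg (hw0 s hs) (sub_nonneg.2 (H.bound _))
      have havg : ∑ s ∈ S.buffer G i k, S.bufferWeight G k i s *
          (∑ l, f l (R.xt s.2 s.1) - b) ≤ (1 - m * a) * ψ ^ 2 := by
        have : ∀ s ∈ S.buffer G i k, S.bufferWeight G k i s * (∑ l, f l (R.xt s.2 s.1) - b) ≤
            S.bufferWeight G k i s * ((1 - m * a) * ψ ^ 2) := by
          intro s hs
          have h1 := Schedule.Regular.sends_of_mem_buffer (j := s.1) (p := s.2) hs
          have h2 := H.regular.le_of_mem_buffer (by omega) hik hs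
          exact mul_le_mul_of_nonneg_left (ih s.2 h1.2 s.1 m (by omega) (by omega) (by omega)
            (h1.1.resolve_left (by omega))) (hw0 s hs)
        have := Finset.sum_le_sum this
        rwa [← Finset.sum_mul, hw2, one_mul] at this
      have hd := hdesc k i hKk hkT hik
      have hm' : ((m : ℝ) + 1) ≤ m₀ := by exact_mod_cast hm
      have hma : 4 * (m + 1) * a ≤ 1 := by
        refine le_trans ?_ hm₀
        have : (4 * ((m : ℝ) + 1)) * a ≤ (4 * m₀) * (α * θ * step) := by gcongr
        exact this
      have hγi : 2 * a ≤ 2 * α * θ * γ i := by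
        have : a ≤ α * θ * γ i := by rw [ha]; have := hγlo i; gcongr
        linarith
      have hm0 : (0 : ℝ) ≤ m := Nat.cast_nonneg m
      have h2a : 0 ≤ 1 - 2 * a := by nlinarith
      have hψ2 := sq_nonneg ψ
      have h1 := mul_le_mul_of_nonneg_right (sub_le_sub_left hγi 1) havg0
      have h2 := mul_le_mul_of_nonneg_left havg h2a
      have h3 := mul_le_mul_of_nonneg_right hC hψ2
      -- Of the decrease `2 a`, one half of `a` pays for the error and another half for the cross
      -- term `2 m a ^ 2`, as `4 m a ≤ 1`.
      have h4 : (1 - 2 * a) * (1 - m * a) + a / 2 ≤ 1 - (m + 1) * a := by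
        nlinarith [mul_nonneg hm0 ha0.le]
      have h5 := mul_le_mul_of_nonneg_right h4 hψ2
      push_cast
      nlinarith
    rcases Nat.eq_zero_or_pos m with rfl | hmpos
    · rcases le_or_gt k K with hkK | hkK
      · simpa using h0 k i (by omega) hkK hik
      · have := main 1 le_rfl (by omega) (by omega)
        refine this.trans ?_
        have : (1 - ((1 : ℕ) : ℝ) * a) ≤ 1 - ((0 : ℕ) : ℝ) * a := by
          push_cast; linarith
        exact mul_le_mul_of_nonneg_right this (sq_nonneg ψ)
    · exact main m hmpos hm hkm

/-- Contraction of the optimality gap by means of the largest stepsize alone. -/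
theorem gap_of_largest (H : Setting G f γ S R X τlo α β θ step b B K₀) {ω : ℝ}
    (hK : K₀ + 2 * B ≤ K) (hT : T = (diameter G + 3) * B) (hω : 0 ≤ ω) (hω1 : ω ≤ 1)
    (hωB : ω ≤ ((n * B : ℕ) : ℝ)⁻¹) {i₁ : Fin n} (hi₁ : γ i₁ = step) (hC0 : 0 ≤ C)
    (hstep : 2 * α * θ * step ≤ 1)
    (h0 : ∀ k i, K < k + B → k ≤ K → i ∈ S.active k → ∑ l, f l (R.xt k i) - b ≤ ψ ^ 2)
    (hdesc : ∀ k i, K < k → k ≤ K + T → i ∈ S.active k → ∑ l, f l (R.xt k i) - b ≤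
      (1 - 2 * α * θ * γ i) * ∑ s ∈ S.buffer G i k, S.bufferWeight G k i s *
        (∑ l, f l (R.xt s.2 s.1) - b) + C * step ^ 2 * ψ ^ 2) :
    ∀ k i, K + T < k + B → k ≤ K + T → i ∈ S.active k → ∑ l, f l (R.xt k i) - b ≤
      (1 - ω ^ T * (2 * α * θ * step) + T * (C * step ^ 2)) * ψ ^ 2 := by
  have hα := H.α_pos
  have hθ := H.θ_pos
  have hs := H.step_nonneg
  have hone := H.regular.one_le
  have hB := H.one_le_B
  intro k j hk hkT hj
  have hTB : T = diameter G * B + 3 * B := by rw [hT]; ring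
  set ε := C * step ^ 2 * ψ ^ 2 with hε
  have hε0 : 0 ≤ ε := by positivity
  have hw := (H.regular.averaging_bufferWeight.mono (K' := K) (by omega)).weaken hωB
  have hwn : ∀ k i, K < k → i ∈ S.active k → ∀ s ∈ S.buffer G i k,
      0 ≤ S.bufferWeight G k i s := fun k i h1 h2 s hs => hω.trans ((hw k i h1 h2).1 s hs)
  have havg : ∀ k i, K < k → i ∈ S.active k → ∑ s ∈ S.buffer G i k, S.bufferWeight G k i s *
      (ψ ^ 2 - (∑ l, f l (R.xt s.2 s.1) - b)) = ψ ^ 2 - ∑ s ∈ S.buffer G i k,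
        S.bufferWeight G k i s * (∑ l, f l (R.xt s.2 s.1) - b) := by
    intro k i h1 h2
    simp only [mul_sub (a := S.bufferWeight G k i _) (b := ψ ^ 2), Finset.sum_sub_distrib]
    rw [← Finset.sum_mul, (hw k i h1 h2).2, one_mul]
  have havg0 : ∀ k i, K < k → i ∈ S.active k → 0 ≤ ∑ s ∈ S.buffer G i k,
      S.bufferWeight G k i s * (∑ l, f l (R.xt s.2 s.1) - b) := fun k i h1 h2 =>
    Finset.sum_nonneg fun s hs => mul_nonneg (hwn k i h1 h2 s hs) (sub_nonneg.2 (H.bound _))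
  -- The decrease at an arbitrary node is discarded here; only that of `i₁` will be counted.
  have hφ : ∀ k i, K < k → k ≤ K + T → i ∈ S.active k →
      ∑ s ∈ S.buffer G i k, S.bufferWeight G k i s *
        (ψ ^ 2 - (∑ l, f l (R.xt s.2 s.1) - b)) - ε ≤ ψ ^ 2 - (∑ l, f l (R.xt k i) - b) := by
    intro k i h1 h2 h3
    rw [havg k i h1 h3]
    have h4 := hdesc k i h1 h2 h3
    have h5 : 0 ≤ 2 * α * θ * γ i := by have := H.step_pos i; positivity
    have h6 := mul_nonneg h5 (havg0 k i h1 h3)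
    linarith
  have hφ0 : ∀ k i, K < k + B → k ≤ K → i ∈ S.active k →
      0 ≤ ψ ^ 2 - (∑ l, f l (R.xt k i) - b) := fun k i h1 h2 h3 => by
    linarith [h0 k i h1 h2 h3]
  obtain ⟨p, hp1, hp2, hp3⟩ := H.regular.exists_active i₁ K (by omega)
  have hpos := hw.superaverage_nonneg (T := T)
    (φ := fun k i => ψ ^ 2 - (∑ l, f l (R.xt k i) - b)) H.regular hω (by omega) hε0 hφ hφ0
  obtain ⟨l, hl, hpath⟩ := exists_hasPath_le_diameter H.connected i₁ j
  have hlB : l * B ≤ diameter G * B := Nat.mul_le_mul_right _ hl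
  obtain ⟨s, hch⟩ := H.regular.exists_chain hpath (by omega) hp3 hj (by omega)
  -- One activation of `i₁` in the first `B` iterations gains the full `2 α θ step`; averaging along
  -- a chain then passes on the fraction `ω ^ T` of it.
  have hstart : 2 * α * θ * step * ψ ^ 2 ≤
      ψ ^ 2 - (∑ l, f l (R.xt p i₁) - b) + (p - K : ℕ) * ε := by
    have h1 := hdesc p i₁ hp1 (by omega) hp3
    rw [hi₁] at h1
    have h2 : ∑ s ∈ S.buffer G i₁ p, S.bufferWeight G p i₁ s * (∑ l, f l (R.xt s.2 s.1) - b) ≤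
        ψ ^ 2 + (p - K - 1 : ℕ) * ε := by
      have h3 : ∀ s ∈ S.buffer G i₁ p, S.bufferWeight G p i₁ s *
          (∑ l, f l (R.xt s.2 s.1) - b) ≤
          S.bufferWeight G p i₁ s * (ψ ^ 2 + (p - K - 1 : ℕ) * ε) := by
        intro s hs'
        have h4 := Schedule.Regular.sends_of_mem_buffer (j := s.1) (p := s.2) hs'
        have h5 := H.regular.le_of_mem_buffer (by omega) hp3 hs'
        refine mul_le_mul_of_nonneg_left ?_ (hwn p i₁ hp1 hp3 s hs')
        have h6 := hpos s.2 s.1 (by omega) (by omega) (h4.1.resolve_left (by omega))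
        have h7 : s.2 - K ≤ p - K - 1 := by omega
        have h8 := mul_le_mul_of_nonneg_right (Nat.cast_le (α := ℝ).2 h7) hε0
        linarith
      have := Finset.sum_le_sum h3
      rwa [← Finset.sum_mul, (hw p i₁ hp1 hp3).2, one_mul] at this
    have h3 := mul_le_mul_of_nonneg_left h2 (sub_nonneg.2 hstep)
    have h4 : ((p - K : ℕ) : ℝ) = (p - K - 1 : ℕ) + 1 := by
      exact_mod_cast (by omega : p - K = p - K - 1 + 1)
    have h5 : 0 ≤ 2 * α * θ * step * ((p - K - 1 : ℕ) * ε) := by positivity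
    rw [h4]
    linarith
  have hend := hw.superaverage_le (T := T)
    (φ := fun k i => ψ ^ 2 - (∑ l, f l (R.xt k i) - b)) H.regular hω hω1 (by omega) hε0 hφ hφ0
    hch hp1.le hkT (by positivity) hstart
  simp only at hend
  rw [hε] at hend
  linarith

end Setting
end APPG

/-! ### Choice of constants and linear convergence -/

namespace APPG

/-- Compatible choices of the constants of the convergence analysis; `κ` is a lower bound for the
contraction of the spreads in `T` iterations. -/
structure Tuned (n d B T : ℕ) (α β θ step g ω κ A Ab c A' Ab' C : ℝ) : Prop where
  T_eq : T = (d + 3) * B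
  ω_pos : 0 < ω
  ω_le_one : ω ≤ 1
  ω_le_buffer : ω ≤ ((n * B : ℕ) : ℝ)⁻¹
  ω_le_mass : ω ≤ (n : ℝ)⁻¹ * θ
  κ_eq : κ = ω ^ T
  g_nonneg : 0 ≤ g
  le_g_sq : 4 * (n * β) ≤ g ^ 2
  A_eq : κ * A = 4 * T * (g + 1)
  Ab_eq : Ab = A + 2 * T * (g + 1)
  c_eq : c = β * Ab / θ
  A'_eq : κ * A' = 4 * T * c
  Ab'_eq : Ab' = A' + 2 * T * c
  C_eq : C = (g + 1) * (Ab' + n * β * Ab) + n * β * (g + 1) ^ 2 + n * β * Ab ^ 2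
  step_spread : (Ab' + n * β * Ab) * step ≤ 1
  step_rate : 4 * (d + 3) * (α * θ * step) ≤ κ
  step_error : 3 * T * (C * step) ≤ κ * (α * θ)

theorem exists_nonneg_bound {n : ℕ} (φ : ℕ → Fin n → ℝ) (K : ℕ) :
    ∃ M, 0 ≤ M ∧ ∀ k i, k ≤ K → φ k i ≤ M := by
  obtain ⟨M, hM⟩ := (((Finset.univ : Finset (Fin n)) ×ˢ Finset.range (K + 1)).image
    fun e => φ e.2 e.1).exists_le
  refine ⟨max M 0, le_max_right _ _, fun k i hk => (hM _ ?_).trans (le_max_left _ _)⟩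
  exact Finset.mem_image.2 ⟨(i, k), by simp; omega, rfl⟩

/-- Only finitely many values are involved, so a large `ψ` works; the initial state need not be near
a minimizer. -/
theorem exists_close {n : ℕ} {E : Type*} [NormedAddCommGroup E] [InnerProductSpace ℝ E]
    (G : Digraph (Fin n)) (f : Fin n → E → ℝ) (S : Schedule n) (R : Trajectory n E)
    {step A A' : ℝ} (b : ℝ) (B : ℕ) (hs : 0 < step) (hA : 0 < A)
    (hA' : 0 < A') (K : ℕ) : ∃ ψ, 0 < ψ ∧ Close G f S R step b A A' B K ψ := by
  obtain ⟨M₁, h1, hM₁⟩ := exists_nonneg_bound (fun k i => ∑ l, f l (R.xt k i) - b) K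
  obtain ⟨M₂, h2, hM₂⟩ := exists_nonneg_bound (fun k i => ‖R.xt k i‖) K
  obtain ⟨M₃, h3, hM₃⟩ := exists_nonneg_bound (fun k i => ‖R.ratio S G k i‖) K
  set ψ := 1 + M₁ + (M₂ + M₂) / (A * step) + (M₃ + M₃) / (A' * step) with hψ
  have h4 : 0 ≤ (M₂ + M₂) / (A * step) := by positivity
  have h5 : 0 ≤ (M₃ + M₃) / (A' * step) := by positivity
  refine ⟨ψ, by linarith, ⟨fun k i _ hk _ => ?_, fun k i k' i' _ hk _ _ hk' _ => ?_,
    fun k i k' i' _ hk _ _ hk' _ => ?_⟩⟩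
  · have := hM₁ k i hk
    nlinarith
  · refine (norm_sub_le _ _).trans ((add_le_add (hM₂ k i hk) (hM₂ k' i' hk')).trans ?_)
    rw [mul_comm, ← div_le_iff₀ (by positivity)]
    linarith
  · refine (norm_sub_le _ _).trans ((add_le_add (hM₃ k i hk) (hM₃ k' i' hk')).trans ?_)
    rw [mul_comm, ← div_le_iff₀ (by positivity)]
    linarith

namespace Setting

variable {n : ℕ} {E : Type*} [NormedAddCommGroup E] [InnerProductSpace ℝ E] [CompleteSpace E]
  {G : Digraph (Fin n)} {f : Fin n → E → ℝ} {γ : Fin n → ℝ} {S : Schedule n} {R : Trajectory n E}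
  {X τlo α β θ step b ψ g ω κ A Ab c A' Ab' C γlo q lam : ℝ} {B K₀ K T : ℕ}

theorem tuned_pos (H : Setting G f γ S R X τlo α β θ step b B K₀)
    (t : Tuned n (diameter G) B T α β θ step g ω κ A Ab c A' Ab' C) :
    0 < T ∧ 0 < κ ∧ κ ≤ 1 ∧ 0 < A ∧ 0 < Ab ∧ 0 < c ∧ 0 < A' ∧ 0 < Ab' ∧ 0 ≤ C := by
  have hB := H.one_le_B
  have hβ := H.β_pos
  have hθ := H.θ_pos
  have hg := t.g_nonneg
  have hT : 0 < T := by rw [t.T_eq]; positivity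
  have hκ : 0 < κ := by rw [t.κ_eq]; have := t.ω_pos; positivity
  have hA : 0 < A := by
    have : 0 < κ * A := by rw [t.A_eq]; positivity
    exact pos_of_mul_pos_right this hκ.le
  have hAb : 0 < Ab := by rw [t.Ab_eq]; positivity
  have hc : 0 < c := by rw [t.c_eq]; positivity
  have hA' : 0 < A' := by
    have : 0 < κ * A' := by rw [t.A'_eq]; positivity
    exact pos_of_mul_pos_right this hκ.le
  have hAb' : 0 < Ab' := by rw [t.Ab'_eq]; positivity
  refine ⟨hT, hκ, ?_, hA, hAb, hc, hA', hAb', ?_⟩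
  · rw [t.κ_eq]; exact pow_le_one₀ t.ω_pos.le t.ω_le_one
  · rw [t.C_eq]; positivity

/-- During `T` iterations, the size `ψ` of the state is multiplied by at most `q`. -/
theorem close_step (H : Setting G f γ S R X τlo α β θ step b B K₀)
    (t : Tuned n (diameter G) B T α β θ step g ω κ A Ab c A' Ab' C)
    (hlo : 0 < γlo) (hγlo : ∀ i, γlo ≤ γ i) {i₁ : Fin n} (hi₁ : γ i₁ = step)
    (hq : 1 - (diameter G + 3) * (α * θ * γlo) / 2 ≤ q) (hK : K₀ + 2 * B ≤ K) (hψ : 0 ≤ ψ)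
    (hcl : Close G f S R step b A A' B K ψ) :
    Close G f S R step b A A' B (K + T) (q * ψ) ∧
      S.Spread B R.xt K (K + T) (Ab * step * ψ) ∧
      ∀ k i, K < k → k ≤ K + T → i ∈ S.active k → ‖R.y k i‖ ≤ (g + 1) * ψ := by
  obtain ⟨hT, hκ, hκ1, hA, hAb, hc, hA', hAb', hC⟩ := H.tuned_pos t
  have hB := H.one_le_B
  have hone := H.regular.one_le
  have hα := H.α_pos
  have hβ := H.β_pos
  have hθ := H.θ_pos
  have hs := H.step_nonneg
  have hg := t.g_nonneg
  have hlos : γlo ≤ step := hi₁ ▸ hγlo i₁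
  obtain ⟨i₀, hi₀⟩ := S.active_nonempty K (by omega)
  have hgrad : ‖gradient (fun v => ∑ l, f l v) (R.xt K i₀)‖ ≤ g * ψ := by
    refine abs_le_of_sq_le_sq' ?_ (by positivity) |>.2
    have hn : 0 < (n : ℝ) := by exact_mod_cast i₀.pos
    have h1 := (lipschitzSmooth_sum H.smooth).norm_gradient_sq_le (by positivity) H.bound
      (R.xt K i₀)
    have h2 := hcl.gap K i₀ (by omega) le_rfl hi₀
    have h3 : 4 * (n * β) * (∑ l, f l (R.xt K i₀) - b) ≤ g ^ 2 * ψ ^ 2 :=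
      mul_le_mul t.le_g_sq h2 (sub_nonneg.2 (H.bound _)) (by positivity)
    calc _ ≤ _ := h1
      _ ≤ _ := h3
      _ = _ := by ring
  have hgrow := H.spread_growth (T := T) (c := c) hK hψ hg hc.le
    (by rw [← t.Ab_eq, t.c_eq]) (by rw [← t.Ab_eq, ← t.Ab'_eq]; exact t.step_spread) hi₀ hgrad
    hcl.spread_xt hcl.spread_ratio T le_rfl
  rw [← t.Ab_eq, ← t.Ab'_eq] at hgrow
  obtain ⟨hxt, hrt⟩ := hgrow
  have hd3 : (0 : ℝ) ≤ diameter G := Nat.cast_nonneg _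
  have hαs : 0 ≤ α * θ * step := by positivity
  have hrate := t.step_rate
  have hsmall : ∀ i, 2 * α * θ * γ i ≤ 1 := by
    intro i
    have h1 : 2 * α * θ * γ i ≤ 2 * α * θ * step := by have := H.step_le i; gcongr
    have h2 : 0 ≤ diameter G * (α * θ * step) := by positivity
    linarith
  have hdesc : ∀ k i, K < k → k ≤ K + T → i ∈ S.active k → _ := fun k i h1 h2 h3 =>
    H.descent hK hψ hAb.le hAb'.le hg t.step_spread hi₀ hgrad h1 (hxt.shrink h2) (hrt.shrink h2) h3
      (hsmall i)
  rw [← t.C_eq] at hdesc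
  have hy : ∀ k i, K < k → k ≤ K + T → i ∈ S.active k → ‖R.y k i‖ ≤ (g + 1) * ψ :=
    fun k i h1 h2 h3 => (hdesc k i h1 h2 h3).1
  have hgapd := fun k i h1 h2 h3 => (hdesc k i h1 h2 h3).2
  refine ⟨⟨?_, ?_, ?_⟩, hxt, hy⟩
  · have hq2 : 1 - (diameter G + 3) * (α * θ * γlo) ≤ q ^ 2 := by
      have h1 : 0 ≤ 1 - (diameter G + 3) * (α * θ * γlo) / 2 := by
        have : α * θ * γlo ≤ α * θ * step := by gcongr
        have : (diameter G + 3) * (α * θ * γlo) ≤ (diameter G + 3) * (α * θ * step) := by gcongr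
        linarith
      have h2 := pow_le_pow_left₀ h1 hq 2
      nlinarith [sq_nonneg (((diameter G : ℝ) + 3) * (α * θ * γlo))]
    have herr := t.step_error
    suffices hmain : ∀ k i, K + T < k + B → k ≤ K + T → i ∈ S.active k →
        ∑ l, f l (R.xt k i) - b ≤ (1 - (diameter G + 3) * (α * θ * γlo)) * ψ ^ 2 by
      intro k i h1 h2 h3
      rw [mul_pow]
      exact (hmain k i h1 h2 h3).trans (by gcongr)
    -- In the first case `step_error` bounds `C * step ^ 2` by `α θ γlo / 3`. In the second, `κ`
    -- times the gain of the largest stepsize, less the accumulated error, exceeds `(d + 3) α θ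
    -- γlo`.
    rcases le_or_gt (κ * step) ((diameter G + 3) * γlo) with hcase | hcase
    · intro k i h1 h2 h3
      have hC' : C * step ^ 2 ≤ α * θ * γlo / 2 := by
        have hTd : (diameter G : ℝ) + 3 ≤ T := by
          rw [t.T_eq]
          exact_mod_cast Nat.le_mul_of_pos_right _ hB
        have e1 : ((diameter G : ℝ) + 3) * (3 * (C * step ^ 2)) ≤ T * (3 * (C * step ^ 2)) := by
          gcongr
        have e2 := mul_le_mul_of_nonneg_right herr hs
        have e3 := mul_le_mul_of_nonneg_right hcase (show 0 ≤ α * θ by positivity)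
        have e4 : ((diameter G : ℝ) + 3) * (3 * (C * step ^ 2)) ≤
            ((diameter G : ℝ) + 3) * (α * θ * γlo) := by linarith
        have e5 := le_of_mul_le_mul_left e4 (by positivity)
        have : 0 ≤ C * step ^ 2 := by positivity
        linarith
      have := H.gap_of_comparable (T := T) (m₀ := diameter G + 3) hK hlo hγlo hcl.gap hgapd hC'
        (by push_cast; linarith) (by omega) k i (diameter G + 3) le_rfl (by rw [← t.T_eq]; exact h1)
        h2 h3
      push_cast at this
      exact this
    · intro k i h1 h2 h3
      have := H.gap_of_largest (T := T) hK t.T_eq t.ω_pos.le t.ω_le_one t.ω_le_buffer hi₁ hC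
        (hi₁ ▸ hsmall i₁) hcl.gap hgapd k i h1 h2 h3
      refine this.trans (mul_le_mul_of_nonneg_right ?_ (sq_nonneg ψ))
      rw [← t.κ_eq]
      have e2 := mul_le_mul_of_nonneg_right herr hs
      have e3 := mul_le_mul_of_nonneg_right hcase.le (show 0 ≤ α * θ by positivity)
      have e4 : 0 ≤ T * (C * step ^ 2) := by positivity
      linarith
  -- As `κ A = 4 T (g + 1)`, the perturbation `2 T (g + 1)` uses half of the contraction: `(1 - κ) A
  -- + κ A / 2 = (1 - κ / 2) A`. The same holds for `A'` and `c`, and `step_rate` ensures `1 - κ / 2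
  -- ≤ q`.
  all_goals
    have hqκ : 1 - κ / 2 ≤ q := by
      refine le_trans ?_ hq
      have h1 : (diameter G + 3) * (α * θ * γlo) ≤ (diameter G + 3) * (α * θ * step) := by gcongr
      have h2 : 0 ≤ (diameter G + 3) * (α * θ * step) := by positivity
      linarith
    have hsψ : 0 ≤ step * ψ := by positivity
  · have := (H.regular.averaging_bufferWeight.mono (K' := K) (by omega)).weaken t.ω_le_buffer
      |>.consensus (z := R.xt) (ε := (g + 1) * step * ψ) H.regular H.connected t.ω_pos.le t.ω_le_one
        (by omega) hB t.T_eq (by positivity) (by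
        intro k i h1 h2 h3
        rw [← H.execution.x_eq (by omega) h3, H.execution.xt_eq (by omega) h3,
          sub_sub_cancel_left, norm_neg, norm_smul, Real.norm_of_nonneg (H.step_pos i).le]
        calc γ i * ‖R.y k i‖ ≤ step * ((g + 1) * ψ) := by
              have := H.step_le i
              have := hy k i h1 h2 h3
              gcongr
          _ = _ := by ring) hcl.spread_xt
    refine Schedule.Spread.weaken (D := (1 - ω ^ T) * (A * step * ψ) +
      2 * (T * ((g + 1) * step * ψ))) this ?_
    rw [← t.κ_eq]
    have h1 : (1 - κ / 2) * A * (step * ψ) ≤ q * A * (step * ψ) := by gcongr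
    have h2 := congrArg (· * (step * ψ)) t.A_eq
    linarith
  · have := ((H.regular.averaging_massWeight H.θ_pos H.mass_ge).mono (K' := K)
        (by omega)).weaken t.ω_le_mass
      |>.consensus (z := R.ratio S G) (ε := c * step * ψ) H.regular H.connected t.ω_pos.le
        t.ω_le_one (by omega) hB t.T_eq (by positivity) (by
        intro k i h1 h2 h3
        obtain ⟨k, rfl⟩ : ∃ k', k = k' + 1 := ⟨k - 1, by omega⟩
        refine (H.norm_ratio_step_le hK (by omega) h3 (hxt.shrink (by omega))).trans (le_of_eq ?_)
        rw [t.c_eq]; ring) hcl.spread_ratio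
    refine Schedule.Spread.weaken (D := (1 - ω ^ T) * (A' * step * ψ) +
      2 * (T * (c * step * ψ))) this ?_
    rw [← t.κ_eq]
    have h1 : (1 - κ / 2) * A' * (step * ψ) ≤ q * A' * (step * ψ) := by gcongr
    have h2 := congrArg (· * (step * ψ)) t.A'_eq
    linarith

/-- Linear convergence with any rate `lam` whose power `lam ^ T` dominates the contraction. -/
theorem converges (H : Setting G f γ S R X τlo α β θ step b B K₀)
    (t : Tuned n (diameter G) B T α β θ step g ω κ A Ab c A' Ab' C)
    (hlo : 0 < γlo) (hγlo : ∀ i, γlo ≤ γ i) {i₁ : Fin n} (hi₁ : γ i₁ = step)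
    (hlam0 : 0 < lam) (hlam1 : lam < 1)
    (hq : 1 - (diameter G + 3) * (α * θ * γlo) / 2 ≤ lam ^ T) :
    ∃ xs, ∑ l, f l xs ≤ b ∧ ∀ i,
      (fun k => ‖R.x k i - xs‖) =O[Filter.atTop] (fun k => lam ^ k) ∧
      (fun k => ‖R.y k i‖) =O[Filter.atTop] (fun k => lam ^ k) := by
  obtain ⟨hT, hκ, hκ1, hA, hAb, hc, hA', hAb', hC⟩ := H.tuned_pos t
  have hs : 0 < step := hi₁ ▸ H.step_pos i₁
  have hg := t.g_nonneg
  have hone := H.regular.one_le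
  have hB := H.one_le_B
  set q := lam ^ T with hqdef
  have hq0 : 0 < q := by positivity
  have hq1 : q < 1 := pow_lt_one₀ hlam0.le hlam1 hT.ne'
  obtain ⟨K₁, hK₁⟩ : ∃ K₁, K₁ = K₀ + 2 * B := ⟨_, rfl⟩
  obtain ⟨ψ, hψ, hcl₀⟩ := exists_close G f S R b B hs hA hA' K₁
  have hcl : ∀ m, Close G f S R step b A A' B (K₁ + m * T) (q ^ m * ψ) := by
    intro m
    induction m with
    | zero => simpa using hcl₀
    | succ m ih =>
      have := (H.close_step t hlo hγlo hi₁ hq (by omega) (by positivity) ih).1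
      rw [Nat.succ_mul, ← add_assoc, pow_succ', mul_assoc]
      exact this
  have hst := fun m => H.close_step t hlo hγlo hi₁ hq (show K₀ + 2 * B ≤ K₁ + m * T by omega)
    (by positivity) (hcl m)
  choose node hnode using fun m => S.active_nonempty (K₁ + m * T) (by omega)
  set D := Ab * step * ψ with hD
  have hD0 : 0 < D := by positivity
  -- One broadcast point is picked at each multiple of `T`; successive ones lie in a common spread
  -- window, so they form a geometric Cauchy sequence.
  have hdist : ∀ m, Dist.dist (R.xt (K₁ + m * T) (node m)) (R.xt (K₁ + (m + 1) * T) (node (m + 1))) ≤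
      D * q ^ m := by
    intro m
    have hTm : K₁ + (m + 1) * T = K₁ + m * T + T := by rw [Nat.succ_mul, add_assoc]
    have h1 := hnode (m + 1)
    rw [dist_eq_norm]
    refine ((hst m).2.1 _ _ _ _ (by omega) (by omega) (hnode m) (by omega) hTm.le h1).trans
      (le_of_eq ?_)
    rw [hD]; ring
  have hcauchy := cauchySeq_of_le_geometric q D hq1 hdist
  obtain ⟨xs, hxs⟩ := cauchySeq_tendsto_of_complete hcauchy
  have hlim := dist_le_of_le_geometric_of_tendsto q D hq1 hdist hxs
  refine ⟨xs, ?_, fun i => ⟨?_, ?_⟩⟩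
  · have hcont : Continuous fun v => ∑ l, f l v :=
      (lipschitzSmooth_sum H.smooth).continuous
    have h1 : Filter.Tendsto (fun m => ∑ l, f l (R.xt (K₁ + m * T) (node m))) Filter.atTop
        (nhds (∑ l, f l xs)) := (hcont.tendsto xs).comp hxs
    have h2 : Filter.Tendsto (fun m => b + (q ^ m * ψ) ^ 2) Filter.atTop
        (nhds (b + (0 * ψ) ^ 2)) :=
      (((tendsto_pow_atTop_nhds_zero_of_lt_one hq0.le hq1).mul_const ψ).pow 2).const_add b
    have h3 := le_of_tendsto_of_tendsto' h1 h2 fun m => by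
      have := (hcl m).gap _ _ (by omega) le_rfl (hnode m)
      linarith
    simpa using h3
  · have hpow : ∀ k m, k ≤ K₁ + m * T + T → q ^ m ≤ lam ^ k / lam ^ (K₁ + T) := by
      intro k m hk
      rw [le_div_iff₀ (by positivity), hqdef, ← pow_mul, ← pow_add]
      exact pow_le_pow_of_le_one hlam0.le hlam1.le (by rw [mul_comm T m]; omega)
    refine Asymptotics.IsBigO.of_bound ((D + D / (1 - q)) / lam ^ (K₁ + T)) ?_
    filter_upwards [Filter.eventually_ge_atTop K₁] with k hk
    have hdiv := Nat.div_add_mod (k - K₁) T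
    have hmod := Nat.mod_lt (k - K₁) hT
    set m := (k - K₁) / T
    rw [mul_comm T m] at hdiv
    have h1 : ‖R.x k i - R.xt (K₁ + m * T) (node m)‖ ≤ Ab * step * (q ^ m * ψ) :=
      H.execution.norm_x_sub_le H.regular (show K₀ + 2 * B ≤ K₁ + m * T by omega) (by omega) i
        fun p j h1 h2 h3 => (hst m).2.1 _ _ _ _ h1 (by omega) h3 (by omega) (by omega) (hnode m)
    have h2 := hlim m
    rw [dist_eq_norm] at h2
    have h3 := norm_add_le (R.x k i - R.xt (K₁ + m * T) (node m))
      (R.xt (K₁ + m * T) (node m) - xs)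
    rw [sub_add_sub_cancel] at h3
    have h4 : 0 < D / (1 - q) := div_pos hD0 (by linarith)
    have h5 := mul_le_mul_of_nonneg_left (hpow k m (by omega)) (show 0 ≤ D + D / (1 - q) by linarith)
    rw [norm_norm, Real.norm_of_nonneg (by positivity)]
    calc ‖R.x k i - xs‖ ≤ (D + D / (1 - q)) * q ^ m := by
          rw [mul_div_right_comm] at h2
          rw [hD] at h2 ⊢
          linarith
      _ ≤ _ := h5
      _ = _ := by ring
  · have hpow : ∀ k m, k ≤ K₁ + m * T + T + B → q ^ m ≤ lam ^ k / lam ^ (K₁ + T + B) := by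
      intro k m hk
      rw [le_div_iff₀ (by positivity), hqdef, ← pow_mul, ← pow_add]
      exact pow_le_pow_of_le_one hlam0.le hlam1.le (by rw [mul_comm T m]; omega)
    refine Asymptotics.IsBigO.of_bound ((g + 1) * ψ / lam ^ (K₁ + T + B)) ?_
    filter_upwards [Filter.eventually_ge_atTop (K₁ + B)] with k hk
    obtain ⟨k', h1, h2, h3, -, h5⟩ := H.execution.exists_last H.regular (k := k) (by omega) i
    -- The bound on `y` holds on `(K, K + T]`, open on the left, hence the `- 1` in choosing the
    -- block.
    have hdiv := Nat.div_add_mod (k' - K₁ - 1) T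
    have hmod := Nat.mod_lt (k' - K₁ - 1) hT
    set m := (k' - K₁ - 1) / T
    rw [mul_comm T m] at hdiv
    have h6 := (hst m).2.2 k' i (by omega) (by omega) h3
    have h7 := mul_le_mul_of_nonneg_left (hpow k m (by omega)) (show 0 ≤ (g + 1) * ψ by positivity)
    rw [norm_norm, Real.norm_of_nonneg (by positivity), h5]
    calc ‖R.y k' i‖ ≤ (g + 1) * ψ * q ^ m := by linarith
      _ ≤ _ := h7
      _ = _ := by ring

end Setting
end APPG

/-! ### Comparison with the stated constants -/

namespace APPG

/-- For `n ≥ 3` the base on the right is at least `2 n ^ 2`, and the powers of 2 absorb the surplus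
factors `n`. For `n = 2` the base is at least 8; with `d = Q = 1` and `s = 0` the left side is 128
and the power on the right only 100, so the factor 2 cannot be omitted. -/
theorem pow_le_two_mul_pow {n Q s d : ℕ} (hn : 2 ≤ n) (hQ : 1 ≤ Q) (hd : 1 ≤ d) :
    n ^ (d + (d + 1) * (Q + s + 2)) ≤
      2 * (n * (2 * ((n - 1) * Q + 1 + n * s) + 1)) ^ (d * ((n - 1) * Q + 1 + n * s)) := by
  obtain ⟨d, rfl⟩ : ∃ d', d = d' + 1 := ⟨d - 1, by omega⟩
  obtain ⟨Q, rfl⟩ : ∃ Q', Q = Q' + 1 := ⟨Q - 1, by omega⟩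
  rcases hn.eq_or_lt with rfl | hn3
  · set b := (2 - 1) * (Q + 1) + 1 + 2 * s with hb
    have hb' : b = Q + 2 + 2 * s := by omega
    have h1 : 2 ^ 3 ≤ 2 * (2 * b + 1) := by omega
    have h2 := Nat.pow_le_pow_left h1 ((d + 1) * b)
    rw [← pow_mul] at h2
    calc 2 ^ (d + 1 + (d + 1 + 1) * (Q + 1 + s + 2)) ≤ 2 ^ (3 * ((d + 1) * b) + 1) := by
          refine Nat.pow_le_pow_right (by norm_num) ?_
          rw [hb']
          nlinarith [Nat.zero_le (d * Q), Nat.zero_le (d * s)]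
      _ = 2 * 2 ^ (3 * ((d + 1) * b)) := by rw [pow_succ]; ring
      _ ≤ _ := by gcongr
  · set b := (n - 1) * (Q + 1) + 1 + n * s with hb
    have h1 : 2 * (Q + 1) ≤ (n - 1) * (Q + 1) := Nat.mul_le_mul_right _ (by omega)
    have h2 : 3 * s ≤ n * s := Nat.mul_le_mul_right _ (by omega)
    have h3 : (n - 1) * 1 ≤ (n - 1) * (Q + 1) := Nat.mul_le_mul_left _ (by omega)
    have hnb : n ≤ b := by
      have : 0 ≤ n * s := Nat.zero_le _
      omega
    have h4 : 2 * n ^ 2 ≤ n * (2 * b + 1) := by nlinarith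
    have h5 : n * n ^ (2 * b) ≤ (2 * n ^ 2) ^ b := by
      rw [mul_pow, ← pow_mul]
      exact Nat.mul_le_mul_right _ (hnb.trans Nat.lt_two_pow_self.le)
    have h6 : 2 * Q + 2 * s + 7 ≤ 2 * b + 1 := by omega
    calc n ^ (d + 1 + (d + 1 + 1) * (Q + 1 + s + 2)) ≤ n ^ ((2 * b + 1) * (d + 1)) := by
          refine Nat.pow_le_pow_right (by omega) ?_
          have := Nat.mul_le_mul_right (d + 1) h6
          nlinarith [Nat.zero_le (d * Q), Nat.zero_le (d * s)]
      _ = (n * n ^ (2 * b)) ^ (d + 1) := by rw [pow_mul, pow_succ' n (2 * b)]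
      _ ≤ ((2 * n ^ 2) ^ b) ^ (d + 1) := Nat.pow_le_pow_left h5 _
      _ = (2 * n ^ 2) ^ ((d + 1) * b) := by rw [← pow_mul, mul_comm b]
      _ ≤ (n * (2 * b + 1)) ^ ((d + 1) * b) := Nat.pow_le_pow_left h4 _
      _ ≤ _ := Nat.le_mul_of_pos_left _ (by norm_num)

theorem one_le_diameter {n : ℕ} (hn : 2 ≤ n) {G : Digraph (Fin n)} (hG : StronglyConnected G) :
    1 ≤ diameter G := by
  obtain ⟨l, hl, hp⟩ := exists_hasPath_le_diameter hG ⟨0, by omega⟩ ⟨1, by omega⟩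
  refine le_trans ?_ hl
  by_contra hlt
  obtain rfl : l = 0 := by omega
  cases hp

/-- The lower bound on the push-sum mass obtained from paths in the time domain. -/
noncomputable def massBound {n : ℕ} (G : Digraph (Fin n)) (τlo τhi τ : ℝ) : ℝ :=
  ((n : ℝ)⁻¹) ^ (diameter G + ((diameter G + 1) * (⌊τhi / τlo⌋₊ + ⌊τ / τlo⌋₊ + 2) - 1))

theorem mul_theta_le {n : ℕ} (hn : 2 ≤ n) {G : Digraph (Fin n)} (hG : StronglyConnected G)
    {τlo τhi τ : ℝ} (hlo : 0 < τlo) (hle : τlo ≤ τhi) :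
    n * theta G τlo τhi τ ≤ 2 * massBound G τlo τhi τ := by
  have hQ : 1 ≤ ⌊τhi / τlo⌋₊ := by
    rw [Nat.one_le_floor_iff, one_le_div hlo]
    exact hle
  have hd := one_le_diameter hn hG
  have h := pow_le_two_mul_pow (s := ⌊τ / τlo⌋₊) hn hQ hd
  have hn0 : (0 : ℝ) < n := by positivity
  unfold theta massBound nAug bInt
  set N := n * (2 * ((n - 1) * ⌊τhi / τlo⌋₊ + 1 + n * ⌊τ / τlo⌋₊) + 1) with hN
  set e := diameter G * ((n - 1) * ⌊τhi / τlo⌋₊ + 1 + n * ⌊τ / τlo⌋₊) with he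
  have hy : 1 ≤ (diameter G + 1) * (⌊τhi / τlo⌋₊ + ⌊τ / τlo⌋₊ + 2) := Nat.mul_pos (by omega) (by omega)
  set z := (diameter G + 1) * (⌊τhi / τlo⌋₊ + ⌊τ / τlo⌋₊ + 2) with hz
  have hN0 : (0 : ℝ) < N := by
    have : 0 < N := by rw [hN]; positivity
    exact_mod_cast this
  have h' : (n : ℝ) ^ (diameter G + (z - 1)) * n ≤ 2 * (N : ℝ) ^ e := by
    rw [← pow_succ, add_assoc, Nat.sub_add_cancel hy]
    exact_mod_cast h
  rw [one_div, inv_pow, inv_pow, ← div_eq_mul_inv, ← div_eq_mul_inv,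
    div_le_div_iff₀ (by positivity) (by positivity)]
  linarith

/-- Each constant is determined by the preceding ones and none involves `step`, so the last three
conditions are mere upper bounds on `step`. -/
theorem exists_tuned (n d B : ℕ) (hn : 0 < n) (hB : 0 < B) {α β θ : ℝ} (hα : 0 < α) (hβ : 0 < β)
    (hθ : 0 < θ) : ∃ γ₀ : ℝ, 0 < γ₀ ∧ ∀ step, 0 ≤ step → step ≤ γ₀ →
      ∃ g ω κ A Ab c A' Ab' C : ℝ,
        Tuned n d B ((d + 3) * B) α β θ step g ω κ A Ab c A' Ab' C := by
  obtain ⟨T, hT⟩ : ∃ T, T = (d + 3) * B := ⟨_, rfl⟩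
  have hT0 : 0 < T := by rw [hT]; positivity
  obtain ⟨ω, hω⟩ : ∃ ω, ω = min ((n * B : ℕ) : ℝ)⁻¹ ((n : ℝ)⁻¹ * θ) := ⟨_, rfl⟩
  have hω0 : 0 < ω := by
    have : 0 < n * B := by positivity
    rw [hω]; positivity
  have hω1 : ω ≤ 1 := by
    rw [hω]
    refine (min_le_left _ _).trans (inv_le_one_of_one_le₀ ?_)
    exact_mod_cast Nat.mul_pos hn hB
  obtain ⟨κ, hκ⟩ : ∃ κ, κ = ω ^ T := ⟨_, rfl⟩
  have hκ0 : 0 < κ := by rw [hκ]; positivity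
  obtain ⟨g, hg⟩ : ∃ g, g = 2 * √(n * β) := ⟨_, rfl⟩
  have hg0 : 0 ≤ g := by rw [hg]; positivity
  obtain ⟨A, hA⟩ : ∃ A, A = 4 * T * (g + 1) / κ := ⟨_, rfl⟩
  obtain ⟨Ab, hAb⟩ : ∃ Ab, Ab = A + 2 * T * (g + 1) := ⟨_, rfl⟩
  obtain ⟨c, hc⟩ : ∃ c, c = β * Ab / θ := ⟨_, rfl⟩
  obtain ⟨A', hA'⟩ : ∃ A', A' = 4 * T * c / κ := ⟨_, rfl⟩
  obtain ⟨Ab', hAb'⟩ : ∃ Ab', Ab' = A' + 2 * T * c := ⟨_, rfl⟩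
  obtain ⟨C, hC⟩ : ∃ C, C = (g + 1) * (Ab' + n * β * Ab) + n * β * (g + 1) ^ 2 +
    n * β * Ab ^ 2 := ⟨_, rfl⟩
  have hA0 : 0 < A := by rw [hA]; positivity
  have hAb0 : 0 < Ab := by rw [hAb]; positivity
  have hc0 : 0 < c := by rw [hc]; positivity
  have hA'0 : 0 < A' := by rw [hA']; positivity
  have hAb'0 : 0 < Ab' := by rw [hAb']; positivity
  have hC0 : 0 < C := by rw [hC]; positivity
  refine ⟨min (1 / (Ab' + n * β * Ab)) (min (κ / (4 * (d + 3) * (α * θ)))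
    (κ * (α * θ) / (3 * T * C))), by positivity, fun step hs hstep => ?_⟩
  rw [le_min_iff, le_min_iff, le_div_iff₀ (by positivity), le_div_iff₀ (by positivity),
    le_div_iff₀ (by positivity)] at hstep
  obtain ⟨h1, h2, h3⟩ := hstep
  rw [← hT]
  refine ⟨g, ω, κ, A, Ab, c, A', Ab', C, hT, hω0, hω1, hω ▸ min_le_left _ _, hω ▸ min_le_right _ _,
    hκ, hg0, ?_, ?_, hAb, hc, ?_, hAb', hC, ?_, ?_, ?_⟩
  · rw [hg, mul_pow, Real.sq_sqrt (by positivity)]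
    norm_num
  · rw [hA, mul_div_cancel₀ _ hκ0.ne']
  · rw [hA', mul_div_cancel₀ _ hκ0.ne']
  · linarith
  · linarith
  · linarith

end APPG

theorem theorem1 (n : ℕ) (hn : 2 ≤ n) (G : Digraph (Fin n)) (hG : APPG.StronglyConnected G)
    (α β : ℝ) (hα : 0 < α) (hβ : 0 < β)
    (τlo τhi τ : ℝ) (hτlo : 0 < τlo) (hτhi : 0 < τhi) (hτ : 0 < τ) :
    ∃ γ₀ : ℝ, 0 < γ₀ ∧
      ∀ (m : ℕ) (f : Fin n → EuclideanSpace ℝ (Fin m) → ℝ),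
        (∀ i, APPG.LipschitzSmooth β (f i)) →
        (APPG.minimizers (fun u => ∑ i, f i u)).Nonempty →
        APPG.PolyakLojasiewicz α (fun u => ∑ i, f i u) →
      ∀ (γ : Fin n → ℝ), (∀ i, 0 < γ i) → (⨆ i, γ i) ≤ γ₀ →
      ∀ (S : APPG.Schedule n), S.BoundedActivation τlo τhi → S.BoundedDelay G τ →
      ∀ (R : APPG.Trajectory n (EuclideanSpace ℝ (Fin m))), APPG.IsExecution G f γ S R →
      ∀ (t : ℕ), 2 * APPG.rho G τlo τhi τ ^ t ≤ APPG.mu G τlo τhi τ →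
      ∀ (lam : ℝ),
        lam ∈ Set.Ioo
          (max (1 - (1 - APPG.theta G τlo τhi τ) / (2 * (t : ℝ)))
            (1 - (⨅ i, γ i) * α * APPG.theta G τlo τhi τ * n / (8 * APPG.bReal n τlo τhi τ))) 1 →
      ∃ xs ∈ APPG.minimizers (fun u => ∑ i, f i u), ∀ i,
        (fun k => ‖R.x k i - xs‖) =O[Filter.atTop] (fun k => lam ^ k) ∧
        (fun k => ‖R.y k i‖) =O[Filter.atTop] (fun k => lam ^ k) := by
  have hn0 : 0 < n := by omega
  have hnR : (0 : ℝ) < n := by exact_mod_cast hn0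
  have : Nonempty (Fin n) := ⟨⟨0, hn0⟩⟩
  -- The asynchrony bound used is `B = n * w`.
  obtain ⟨w, hw⟩ : ∃ w, w = ⌈(τhi + τ) / τlo⌉₊ := ⟨_, rfl⟩
  have hwX : τhi + τ ≤ w * τlo := by
    rw [← div_le_iff₀ hτlo, hw]
    exact Nat.le_ceil _
  have hw0 : 0 < w := by
    rw [hw, Nat.ceil_pos]
    positivity
  obtain ⟨θ, hθ⟩ : ∃ θ, θ = APPG.massBound G τlo τhi τ := ⟨_, rfl⟩
  have hθ0 : 0 < θ := by
    rw [hθ, APPG.massBound]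
    positivity
  have hB : 0 < n * w := Nat.mul_pos hn0 hw0
  obtain ⟨γ₀, hγ₀, htuned⟩ := APPG.exists_tuned n (APPG.diameter G) (n * w) hn0 hB hα hβ hθ0
  refine ⟨γ₀, hγ₀, ?_⟩
  rintro m f hf ⟨xmin, hxmin⟩ hPL γ hγ hγle S hA hD R hR t _ lam ⟨hlam, hlam1⟩
  have hle : τlo ≤ τhi := hA.lo_le_hi ⟨0, hn0⟩
  obtain ⟨K₀, hreg⟩ := APPG.Schedule.exists_regular hA hD hτlo hτhi hτ hwX
  have hy : τhi + τ < (⌊τhi / τlo⌋₊ + ⌊τ / τlo⌋₊ + 2 : ℕ) * τlo := by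
    have h1 := Nat.lt_floor_add_one (τhi / τlo)
    have h2 := Nat.lt_floor_add_one (τ / τlo)
    rw [div_lt_iff₀ hτlo] at h1 h2
    push_cast
    linarith
  obtain ⟨K₁, hK₁, hmass⟩ := hreg.exists_le_mass hG hτlo (hA.exists_time_ge hτlo) hy
  obtain ⟨i₁, hi₁⟩ := exists_eq_ciSup_of_finite (f := γ)
  obtain ⟨i₂, hi₂⟩ := exists_eq_ciInf_of_finite (f := γ)
  have hsup : ∀ i, γ i ≤ ⨆ i, γ i := le_ciSup (Set.finite_range γ).bddAbove
  have hinf : ∀ i, (⨅ i, γ i) ≤ γ i := ciInf_le (Set.finite_range γ).bddBelow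
  have hlo : 0 < ⨅ i, γ i := hi₂ ▸ hγ i₂
  have hmin : (⨅ v, ∑ i, f i v) = ∑ i, f i xmin :=
    le_antisymm (ciInf_le ⟨_, by rintro _ ⟨v, rfl⟩; exact hxmin v⟩ xmin) (le_ciInf hxmin)
  have H : APPG.Setting G f γ S R (τhi + τ) τlo α β θ (⨆ i, γ i) (∑ i, f i xmin) (n * w) K₁ :=
    { connected := hG
      execution := hR
      regular := hreg.mono hK₁
      one_le_B := hB
      θ_pos := hθ0
      α_pos := hα
      β_pos := hβ
      mass_ge := by rw [hθ]; exact hmass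
      smooth := hf
      step_pos := hγ
      step_le := hsup
      bound := hxmin
      dominated := fun u => by rw [← hmin]; exact hPL u }
  obtain ⟨g, ω, κ, A, Ab, c, A', Ab', C, ht⟩ := htuned _ (hi₁ ▸ (hγ i₁).le) hγle
  have hκ1 := (H.tuned_pos ht).2.2.1
  have hrate := ht.step_rate
  set a := α * θ * ⨅ i, γ i with ha
  have ha0 : 0 < a := by positivity
  have ha1 : 4 * (APPG.diameter G + 3) * a ≤ 1 := by
    refine le_trans ?_ (hrate.trans hκ1)
    have := (hinf i₁).trans (hsup i₁)
    rw [ha]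
    gcongr
  have hBR : (1 : ℝ) ≤ (n * w : ℕ) := by exact_mod_cast hB
  have hd0 : (0 : ℝ) ≤ APPG.diameter G := Nat.cast_nonneg _
  have ha2 : a / (2 * (n * w : ℕ)) ≤ 1 := by
    rw [div_le_one (by positivity)]
    nlinarith
  have hbR : ((n * w : ℕ) : ℝ) ≤ 2 * APPG.bReal n τlo τhi τ := by
    -- Rounding up at most doubles a number that is at least 1.
    have h1 : (w : ℝ) < (τhi + τ) / τlo + 1 := by
      rw [hw]
      exact Nat.ceil_lt_add_one (by positivity)
    have h2 : 1 ≤ (τhi + τ) / τlo := by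
      rw [one_le_div hτlo]
      linarith
    push_cast
    rw [APPG.bReal, mul_div_assoc]
    have := mul_le_mul_of_nonneg_left (show (w : ℝ) ≤ 2 * ((τhi + τ) / τlo) by linarith) hnR.le
    linarith
  have hb0 : 0 < APPG.bReal n τlo τhi τ := by
    unfold APPG.bReal
    positivity
  have hθn := APPG.mul_theta_le (τ := τ) hn hG hτlo hle
  rw [← hθ] at hθn
  -- The 8 is 2 from halving the rate of the gap for `ψ`, 2 from comparing `n * theta` with the mass
  -- bound, and 2 from the rounding in `w`.
  have hstep : (⨅ i, γ i) * α * APPG.theta G τlo τhi τ * n / (8 * APPG.bReal n τlo τhi τ) ≤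
      a / (2 * (n * w : ℕ)) := by
    rw [div_le_div_iff₀ (by positivity) (by positivity)]
    have h1 : (n * APPG.theta G τlo τhi τ) * (n * w : ℕ) ≤
        (2 * θ) * (2 * APPG.bReal n τlo τhi τ) :=
      mul_le_mul hθn hbR (by positivity) (by positivity)
    have h2 := mul_le_mul_of_nonneg_left h1 (show 0 ≤ 2 * ((⨅ i, γ i) * α) by positivity)
    rw [ha]
    linarith
  have hlam' : 1 + -(a / (2 * (n * w : ℕ))) < lam := by
    have := (le_max_right _ _).trans_lt hlam
    linarith
  have hlam0 : 0 < lam := by linarith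
  -- Bernoulli's inequality: `T = (d + 3) n w` iterations at rate `1 - a / (2 n w)` leave at least
  -- `1 - (d + 3) a / 2`.
  have hq : 1 - (APPG.diameter G + 3) * (α * θ * ⨅ i, γ i) / 2 ≤
      lam ^ ((APPG.diameter G + 3) * (n * w)) := by
    refine le_trans ?_ (pow_le_pow_left₀ (by linarith) hlam'.le _)
    refine le_trans (le_of_eq ?_) (one_add_mul_le_pow (by linarith) _)
    rw [← ha]
    push_cast
    have : (w : ℝ) ≠ 0 := by positivity
    field_simp
    ring
  obtain ⟨xs, hxs, hconv⟩ := H.converges ht hlo hinf hi₁ hlam0 hlam1 hq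
  exact ⟨xs, fun v => hxs.trans (hxmin v), hconv⟩
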